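/- Notation. $H^m_{per}$ denotes the space of $1$-periodic functions on $\mathbb R$ whose weak derivatives up to order $m$ are square integrable over a period, with the norm of $H^m([0,1])$; $L^2_{per}=H^0_{per}$. For a $1$-periodic function $v$ put $$F(v)=\frac12\int_0^1 v^2\,dh,\qquad E(v)=\frac16\int_0^1\big[(v^3)_{hh}\big]^2\,dh ,$$ with $E(v)=+\infty$ if $v^3\notin H^2_{per}$. For $T>0$ and a function $u(t,h)$ that is $1$-periodic in $h$, let $P_T=\{(t,h)\in(0,T)\times(0,1): u(t,h)\ne 0\}$. A non-negative function $u(t,h)$, $1$-periodic and continuous in $h$, with $$u^3\in L^\infty([0,T];H^2_{per})\cap C([0,T];H^1_{per}),\qquad u_t\in L^2([0,T];L^2_{per}),\qquad u^2(u^3)_{hhhh}\in L^2(P_T)$$ and $u(0,\cdot)=u_0$ a.e. is called a weak solution on $[0,T]$ of $u_t=-u^2(u^3)_{hhhh}$ with initial data $u_0$ if 1. $\displaystyle\int_0^T\!\!\int_0^1 \phi\,u_t\,dh\,dt+\iint_{P_T}\phi\,u^2(u^3)_{hhhh}\,dh\,dt=0$ for every $\phi\in C^\infty([0,T]\times\mathbb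 R)$ that is $1$-periodic in $h$; 2. $\displaystyle E(u(T,\cdot))+\iint_{P_T}\big(u^2(u^3)_{hhhh}\big)^2dh\,dt\le E(u(0,\cdot))$; 3. $\displaystyle F(u(T,\cdot))+6\int_0^TE(u(t,\cdot))\,dt\le F(u(0,\cdot))$. Here $u_t$ and $(u^3)_{hhhh}$ are distributional derivatives; $(u^3)_{hhhh}$ is taken, in the periodic setting, on the open set $\{(t,h)\in(0,T)\times\mathbb R: u(t,h)\neq0\}$. A global weak solution is a function $u$ on $[0,\infty)\times\mathbb R$ that is a weak solution on $[0,T]$ for every $T>0$. Theorem. Let $u_0\ge 0$ (a.e.) with $u_0^3\in H^2_{per}$ and $\int_0^1\frac1{u_0}\,dh<+\infty$, and let $u$ be any global weak solution of $u_t=-u^2(u^3)_{hhhh}$ with initial data $u_0$. Then there exists a constant $u^\star\in\mathbb R$ such that, as $t\to+\infty$, $$\|u(t,\cdot)^3-(u^\star)^3\|_{H^1([0,1])}\to0\qquad\text{and}\qquad \|u(t,\cdot)-u^\star\|_{L^\infty([0,1])}\to0 .$$ -/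

import Mathlib

open MeasureTheory Filter Topology
open scoped ContDiff ENNReal NNReal

namespace Vicinal

/-! Functions of the height `h : ℝ`, one period being `(0,1)`. -/

/-- `g` is the `k`-th weak derivative of `f` on `ℝ`. -/
def IsWeakDeriv (k : ℕ) (f g : ℝ → ℝ) : Prop :=
  LocallyIntegrable f ∧ LocallyIntegrable g ∧
    ∀ φ : ℝ → ℝ, ContDiff ℝ ∞ φ → HasCompactSupport φ →
      ∫ h, f h * iteratedDeriv k φ h = (-1) ^ k * ∫ h, g h * φ h

open Classical in
/-- The `k`-th weak derivative of `f` (unique up to a null set), and `0` if there is none. -/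
noncomputable def weakDeriv (k : ℕ) (f : ℝ → ℝ) : ℝ → ℝ :=
  if H : ∃ g, IsWeakDeriv k f g then H.choose else 0

/-- The periodic Sobolev space `H^m_per([0,1])`: `f` is `1`-periodic (almost everywhere) and its
weak derivatives on `ℝ` up to order `m` exist and are square integrable over a period. -/
def MemHper (m : ℕ) (f : ℝ → ℝ) : Prop :=
  (∀ᵐ h : ℝ, f (h + 1) = f h) ∧
    ∀ k ≤ m, ∃ g, IsWeakDeriv k f g ∧ MemLp g 2 (volume.restrict (Set.Ioo (0 : ℝ) 1))

open Classical in
/-- The norm of `H^m([0,1])` on `H^m_per([0,1])`, with value `⊤` outside this space. -/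
noncomputable def hperNorm (m : ℕ) (f : ℝ → ℝ) : ℝ≥0∞ :=
  if MemHper m f then
    (∑ k ∈ Finset.range (m + 1), ∫⁻ h in Set.Ioo (0 : ℝ) 1, ‖weakDeriv k f h‖ₑ ^ 2) ^ (1 / 2 : ℝ)
  else ⊤

/-- `F(v) = (1/2) ∫₀¹ v² dh`. -/
noncomputable def freeEnergy (v : ℝ → ℝ) : ℝ≥0∞ :=
  2⁻¹ * ∫⁻ h in Set.Ioo (0 : ℝ) 1, ‖v h‖ₑ ^ 2

open Classical in
/-- `E(v) = (1/6) ∫₀¹ [(v³)_{hh}]² dh`, with value `⊤` unless `v³ ∈ H²_per([0,1])`. -/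
noncomputable def energy (v : ℝ → ℝ) : ℝ≥0∞ :=
  if MemHper 2 (fun h => v h ^ 3) then
    6⁻¹ * ∫⁻ h in Set.Ioo (0 : ℝ) 1, ‖weakDeriv 2 (fun h => v h ^ 3) h‖ₑ ^ 2
  else ⊤

/-! Functions of `(t, h) : ℝ × ℝ`. -/

/-- `g` is the weak partial derivative `f_t` on the open set `Ω`. -/
def IsWeakDt (Ω : Set (ℝ × ℝ)) (f g : ℝ × ℝ → ℝ) : Prop :=
  LocallyIntegrableOn f Ω ∧ LocallyIntegrableOn g Ω ∧
    ∀ φ : ℝ × ℝ → ℝ, ContDiff ℝ ∞ φ → HasCompactSupport φ → tsupport φ ⊆ Ω →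
      ∫ p in Ω, f p * deriv (fun s => φ (s, p.2)) p.1 = -∫ p in Ω, g p * φ p

/-- `g` is the weak partial derivative `f_{hhhh}` on the open set `Ω`. -/
def IsWeakDhhhh (Ω : Set (ℝ × ℝ)) (f g : ℝ × ℝ → ℝ) : Prop :=
  LocallyIntegrableOn f Ω ∧ LocallyIntegrableOn g Ω ∧
    ∀ φ : ℝ × ℝ → ℝ, ContDiff ℝ ∞ φ → HasCompactSupport φ → tsupport φ ⊆ Ω →
      ∫ p in Ω, f p * iteratedDeriv 4 (fun y => φ (p.1, y)) p.2 = ∫ p in Ω, g p * φ p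

/-- `(0,T) × ℝ` without the zero set of `u`; here `h` runs over all of `ℝ`, so that derivatives
of periodic functions are also taken across the ends of a period. -/
def positiveSet (T : ℝ) (u : ℝ → ℝ → ℝ) : Set (ℝ × ℝ) :=
  {p | p.1 ∈ Set.Ioo 0 T ∧ u p.1 p.2 ≠ 0}

/-- `P_T = (0,T) × (0,1) \ {u = 0}`: one period of `positiveSet T u`. -/
def periodPositiveSet (T : ℝ) (u : ℝ → ℝ → ℝ) : Set (ℝ × ℝ) :=
  {p | p.1 ∈ Set.Ioo 0 T ∧ p.2 ∈ Set.Ioo (0 : ℝ) 1 ∧ u p.1 p.2 ≠ 0}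

/-- `u = u(t,h)` is a (non-negative, `1`-periodic in `h`) weak solution of
`u_t = -u² (u³)_{hhhh}` on `[0,T]` with initial data `u₀`. The functions `u(t,·)` are the
continuous representatives. -/
structure IsWeakSolution (T : ℝ) (u : ℝ → ℝ → ℝ) (u₀ : ℝ → ℝ) : Prop where
  nonneg : ∀ t ∈ Set.Icc 0 T, ∀ h, 0 ≤ u t h
  continuous_slice : ∀ t ∈ Set.Icc 0 T, Continuous (u t)
  initial : u 0 =ᵐ[volume] u₀
  /-- `u³ ∈ L^∞([0,T]; H²_per)` -/
  cube_Linfty_H2 : ∃ M : ℝ≥0, ∀ᵐ t ∂(volume.restrict (Set.Icc 0 T)),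
    hperNorm 2 (fun h => u t h ^ 3) ≤ M
  /-- `u³ ∈ C([0,T]; H¹_per)` -/
  cube_mem_H1 : ∀ t ∈ Set.Icc 0 T, MemHper 1 (fun h => u t h ^ 3)
  cube_continuous_H1 : ∀ s ∈ Set.Icc 0 T,
    Tendsto (fun t => hperNorm 1 (fun h => u t h ^ 3 - u s h ^ 3)) (𝓝[Set.Icc 0 T] s) (𝓝 0)
  /-- Here `ut = u_t` and `g = (u³)_{hhhh}`. -/
  equation : ∃ ut g : ℝ × ℝ → ℝ,
    IsWeakDt (Set.Ioo 0 T ×ˢ Set.univ) (fun p => u p.1 p.2) ut ∧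
    MemLp ut 2 (volume.restrict (Set.Ioo 0 T ×ˢ Set.Ioo (0 : ℝ) 1)) ∧
    IsWeakDhhhh (positiveSet T u) (fun p => u p.1 p.2 ^ 3) g ∧
    MemLp (fun p => u p.1 p.2 ^ 2 * g p) 2 (volume.restrict (periodPositiveSet T u)) ∧
    (∀ φ : ℝ × ℝ → ℝ, ContDiffOn ℝ ∞ φ (Set.Icc 0 T ×ˢ Set.univ) →
      (∀ t ∈ Set.Icc 0 T, ∀ h, φ (t, h + 1) = φ (t, h)) →
      (∫ p in Set.Ioo 0 T ×ˢ Set.Ioo (0 : ℝ) 1, φ p * ut p) +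
        ∫ p in periodPositiveSet T u, φ p * (u p.1 p.2 ^ 2 * g p) = 0) ∧
    energy (u T) + ∫⁻ p in periodPositiveSet T u, ‖u p.1 p.2 ^ 2 * g p‖ₑ ^ 2 ≤ energy (u 0)
  second_dissipation :
    freeEnergy (u T) + 6 * ∫⁻ t in Set.Ioo 0 T, energy (u t) ≤ freeEnergy (u 0)

/-- A global weak solution: a weak solution on `[0,T]` for every `T > 0`. -/
def IsGlobalWeakSolution (u : ℝ → ℝ → ℝ) (u₀ : ℝ → ℝ) : Prop :=
  ∀ T : ℝ, 0 < T → IsWeakSolution T u u₀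

end Vicinal

namespace Vicinal

/-! Write `m(t)` for the spatial mean of `u(t,·)` and `D(t)` for `cubeDeviation (u t)`, the squared
`L²` distance between `u³` and `m³`. Poincaré's inequality on the circle gives `D ≤ ‖(u³)_h‖² ≤
‖(u³)_hh‖² = 6 E(u)`, so the dissipation of `F` makes `D` integrable over all times. The dissipation
of `E` bounds `u_t` in `L²` of space-time uniformly in `T`, so `u` is 1/2-Hölder in time with values
in `L²`, and therefore `D` is 1/2-Hölder too. An integrable, uniformly Hölder function tends to
zero, so `D → 0`. Interpolation against the bounded quantity `‖(u³)_hh‖` gives `(u³)_h → 0` in `L²`,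
hence `u - m → 0` uniformly.

It remains to show that `m` converges, which is `exists_tendsto_mean`. If `m → 0` nothing is left to
prove. Otherwise `m` is at least some `4δ` at arbitrarily late times. While `m ≥ 2δ` at late times,
`u ≥ δ`, and the equation may be divided by `u²`: the function `k = u_t / u² = -(u³)_hhhh` has
spatial mean zero for almost every time, by periodicity. Hence the increments of `m` are the
integrals of `u_t = u² k`, which equal those of `(u² - m²) k`, and by Cauchy-Schwarz `(m(t) - m(s))²
≤ δ⁻⁶ E(u(0)) ∫ₛᵗ D` (`sq_mean_sub_le`). The tail of `∫ D` tends to zero, so after a late time `m`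
can no longer fall from `4δ` to `2δ`. The estimate then holds forever and makes `m` Cauchy. -/

/-! ### Cauchy-Schwarz and weak derivatives on an interval. -/

lemma sq_integral_mul_le {α : Type*} [MeasurableSpace α] {μ : Measure α} {f g : α → ℝ}
    (hf : MemLp f 2 μ) (hg : MemLp g 2 μ) :
    (∫ x, f x * g x ∂μ) ^ 2 ≤ (∫ x, f x ^ 2 ∂μ) * ∫ x, g x ^ 2 ∂μ := by
  have hfi := hf.integrable_sq
  have hgi := hg.integrable_sq
  have hfg : Integrable (fun x => f x * g x) μ := hf.integrable_mul hg
  have key : ∀ s : ℝ, 0 ≤ (∫ x, g x ^ 2 ∂μ) * (s * s) + (2 * ∫ x, f x * g x ∂μ) * s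
      + ∫ x, f x ^ 2 ∂μ := by
    intro s
    have h0 : 0 ≤ ∫ x, (f x + s * g x) ^ 2 ∂μ := integral_nonneg fun x => sq_nonneg _
    have h1 : ∫ x, (f x + s * g x) ^ 2 ∂μ
        = ∫ x, (f x ^ 2 + ((2 * s) * (f x * g x) + (s * s) * g x ^ 2)) ∂μ := by
      congr 1; ext x; ring
    have hs1 := hfg.const_mul (2 * s)
    have hs2 := hgi.const_mul (s * s)
    have hsum : Integrable (fun x => (2 * s) * (f x * g x) + (s * s) * g x ^ 2) μ := hs1.add hs2
    rw [h1, integral_add hfi hsum, integral_add hs1 hs2,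
      integral_const_mul, integral_const_mul] at h0
    linarith
  have := discrim_le_zero key
  unfold discrim at this
  nlinarith

lemma exists_Icc_of_isCompact_subset_Ioo {a b : ℝ} (hab : a < b) {K : Set ℝ} (hK : IsCompact K)
    (hKs : K ⊆ Set.Ioo a b) : ∃ a' b', a < a' ∧ a' < b' ∧ b' < b ∧ K ⊆ Set.Icc a' b' := by
  rcases K.eq_empty_or_nonempty with rfl | hne
  · refine ⟨(2 * a + b) / 3, (a + 2 * b) / 3, ?_, ?_, ?_, by simp⟩ <;> linarith
  · have h1 := hKs (hK.sInf_mem hne)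
    have h2 := hKs (hK.sSup_mem hne)
    have h3 : sInf K ≤ sSup K := (hK.isLeast_sInf hne).2 (hK.sSup_mem hne)
    refine ⟨(a + sInf K) / 2, (b + sSup K) / 2, by linarith [h1.1], ?_, by linarith [h2.2], ?_⟩
    · linarith
    · intro x hx
      have := (hK.isLeast_sInf hne).2 hx
      have := (hK.isGreatest_sSup hne).2 hx
      exact ⟨by linarith [h1.1], by linarith [h2.2]⟩

lemma intervalIntegrable_mul_of_continuous {a b : ℝ} {f φ : ℝ → ℝ}
    (hf : IntervalIntegrable f volume a b) (hφ : Continuous φ) :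
    IntervalIntegrable (fun x => f x * φ x) volume a b :=
  hf.mul_continuousOn hφ.continuousOn

/-- Integration by parts for two primitives of integrable functions. -/
lemma integral_mul_primitive {a b : ℝ} {A B α β : ℝ → ℝ}
    (hα : IntervalIntegrable α volume a b) (hβ : IntervalIntegrable β volume a b)
    (hA : ∀ x ∈ Set.uIcc a b, A x = A a + ∫ y in a..x, α y)
    (hB : ∀ x ∈ Set.uIcc a b, B x = B a + ∫ y in a..x, β y) :
    ∫ x in a..b, A x * β x = A b * B b - A a * B a - ∫ x in a..b, α x * B x := by
  set A' : ℝ → ℝ := fun x => A a + ∫ y in a..x, α y with hA'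
  set B' : ℝ → ℝ := fun x => B a + ∫ y in a..x, β y with hB'
  have hc : ∀ c : ℝ, AbsolutelyContinuousOnInterval (fun _ => c) a b := fun c =>
    (contDiffOn_const (n := 1)).absolutelyContinuousOnInterval
  have acA : AbsolutelyContinuousOnInterval A' a b :=
    (hc _).fun_add (hα.absolutelyContinuousOnInterval_intervalIntegral (by simp))
  have acB : AbsolutelyContinuousOnInterval B' a b :=
    (hc _).fun_add (hβ.absolutelyContinuousOnInterval_intervalIntegral (by simp))
  have key := acA.integral_mul_deriv_eq_deriv_mul acB
  have e1 : ∫ x in a..b, A' x * deriv B' x = ∫ x in a..b, A x * β x := by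
    apply intervalIntegral.integral_congr_ae
    filter_upwards [hβ.ae_hasDerivAt_integral] with x hx hx'
    have hx'' := Set.uIoc_subset_uIcc hx'
    rw [hA x hx'', ((hx hx'' a (by simp)).const_add (B a)).deriv]
  have e2 : ∫ x in a..b, deriv A' x * B' x = ∫ x in a..b, α x * B x := by
    apply intervalIntegral.integral_congr_ae
    filter_upwards [hα.ae_hasDerivAt_integral] with x hx hx'
    have hx'' := Set.uIoc_subset_uIcc hx'
    rw [hB x hx'', ((hx hx'' a (by simp)).const_add (A a)).deriv]
  rw [e1, e2] at key
  rw [key, hA b (by simp), hB b (by simp)]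
  simp [hA', hB']

/-- A function on an interval with vanishing weak derivative is constant. -/
lemma exists_const_of_weakDeriv_zero {a b : ℝ} (hab : a < b) {f : ℝ → ℝ}
    (hf : IntervalIntegrable f volume a b)
    (h : ∀ φ : ℝ → ℝ, ContDiff ℝ ∞ φ → HasCompactSupport φ → tsupport φ ⊆ Set.Ioo a b →
      ∫ x in a..b, f x * deriv φ x = 0) :
    ∃ c : ℝ, ∀ᵐ x : ℝ, x ∈ Set.Ioo a b → f x = c := by
  obtain ⟨θ, hθ, hθc, hθs, hθ1⟩ : ∃ θ : ℝ → ℝ, ContDiff ℝ ∞ θ ∧ HasCompactSupport θ ∧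
      tsupport θ ⊆ Set.Ioo a b ∧ ∫ x in a..b, θ x = 1 := by
    let B : ContDiffBump ((a + b) / 2) :=
      ⟨(b - a) / 8, (b - a) / 4, by linarith, by linarith⟩
    have hs : tsupport (B.normed volume) ⊆ Set.Ioo a b := by
      rw [B.tsupport_normed_eq, Real.closedBall_eq_Icc]
      intro x hx
      have h1 : a + b - (b - a) / 2 ≤ 2 * x := by have := hx.1; simp only [B] at this; linarith
      have h2 : 2 * x ≤ a + b + (b - a) / 2 := by have := hx.2; simp only [B] at this; linarith
      exact ⟨by linarith, by linarith⟩
    refine ⟨B.normed volume, B.contDiff_normed, B.hasCompactSupport_normed, hs, ?_⟩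
    rw [← B.integral_normed (μ := volume)]
    apply intervalIntegral.integral_eq_integral_of_support_subset
    exact ((subset_tsupport _).trans hs).trans Set.Ioo_subset_Ioc_self
  refine ⟨∫ x in a..b, f x * θ x, ?_⟩
  set c := ∫ x in a..b, f x * θ x with hc
  have hloc : LocallyIntegrableOn (fun x => f x - c) (Set.Ioo a b) := by
    apply IntegrableOn.locallyIntegrableOn
    have := (intervalIntegrable_iff_integrableOn_Ioo_of_le hab.le).1
      (hf.sub (intervalIntegrable_const (c := c)))
    exact this
  have := isOpen_Ioo.ae_eq_zero_of_integral_contDiff_smul_eq_zero hloc ?_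
  · filter_upwards [this] with x hx hx'
    linarith [hx hx']
  intro ψ hψ hψc hψs
  set d := ∫ x in a..b, ψ x with hd
  -- Subtracting `d * θ` makes the integral vanish, so the primitive `φ` of `k` is again a test
  -- function. Testing with `φ` then gives `∫ f ψ = c ∫ ψ`.
  set k : ℝ → ℝ := fun x => ψ x - d * θ x with hk
  have hkc : ContDiff ℝ ∞ k := hψ.sub (contDiff_const.mul hθ)
  have hks : ∀ x, x ∉ tsupport ψ ∪ tsupport θ → k x = 0 := by
    intro x hx
    simp only [Set.mem_union, not_or] at hx
    simp [hk, image_eq_zero_of_notMem_tsupport hx.1, image_eq_zero_of_notMem_tsupport hx.2]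
  obtain ⟨a', b', haa', hab', hbb', hK⟩ := exists_Icc_of_isCompact_subset_Ioo hab
    (hψc.isCompact.union hθc.isCompact) (Set.union_subset hψs hθs)
  have hkz : ∀ x, x ∉ Set.Icc a' b' → k x = 0 := fun x hx => hks x fun h => hx (hK h)
  set φ : ℝ → ℝ := fun x => ∫ y in a..x, k y with hφ
  have hderiv : ∀ x, HasDerivAt φ (k x) x := fun x =>
    intervalIntegral.integral_hasDerivAt_right (hkc.continuous.intervalIntegrable _ _)
      hkc.continuous.stronglyMeasurable.stronglyMeasurableAtFilter hkc.continuous.continuousAt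
  have hdφ : deriv φ = k := funext fun x => (hderiv x).deriv
  have hφ_smooth : ContDiff ℝ ∞ φ := by
    rw [contDiff_infty_iff_deriv, hdφ]
    exact ⟨fun x => (hderiv x).differentiableAt, hkc⟩
  have hkb : ∫ x in a..b, k x = 0 := by
    simp only [hk]
    rw [intervalIntegral.integral_sub (hψ.continuous.intervalIntegrable _ _)
      ((hθ.continuous.intervalIntegrable _ _).const_mul d),
      intervalIntegral.integral_const_mul, hθ1, mul_one, sub_self]
  have hφz : ∀ x, x ∉ Set.Icc a' b' → φ x = 0 := by
    intro x hx
    rcases lt_or_ge x a' with hxa | hxa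
    · apply intervalIntegral.integral_zero_ae
      refine Eventually.of_forall fun y hy => hkz y fun hy' => ?_
      have := hy.2
      have h3 : max a x < a' := max_lt haa' hxa
      linarith [hy'.1]
    · have hxb : b' < x := by
        by_contra hcon
        exact hx ⟨hxa, not_lt.1 hcon⟩
      have : φ x = (∫ y in a..b, k y) + ∫ y in b..x, k y :=
        (intervalIntegral.integral_add_adjacent_intervals (hkc.continuous.intervalIntegrable _ _)
          (hkc.continuous.intervalIntegrable _ _)).symm
      rw [this, hkb, zero_add]
      apply intervalIntegral.integral_zero_ae
      refine Eventually.of_forall fun y hy => hkz y fun hy' => ?_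
      have h3 : b' < min b x := lt_min hbb' hxb
      linarith [hy.1, hy'.2]
  have hsupp : tsupport φ ⊆ Set.Icc a' b' := by
    apply closure_minimal _ isClosed_Icc
    intro x hx
    by_contra hcon
    exact hx (hφz x hcon)
  have hφc : HasCompactSupport φ := HasCompactSupport.intro isCompact_Icc hφz
  have h0 := h φ hφ_smooth hφc
    (hsupp.trans fun x hx => ⟨haa'.trans_le hx.1, hx.2.trans_lt hbb'⟩)
  rw [hdφ] at h0
  have hfψ := intervalIntegrable_mul_of_continuous hf hψ.continuous
  have hfθ := intervalIntegrable_mul_of_continuous hf hθ.continuous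
  have h1 : ∫ x in a..b, f x * k x = (∫ x in a..b, f x * ψ x) - d * c := by
    have : ∀ x, f x * k x = f x * ψ x - d * (f x * θ x) := fun x => by simp only [hk]; ring
    simp_rw [this]
    rw [intervalIntegral.integral_sub hfψ (hfθ.const_mul d), intervalIntegral.integral_const_mul]
  have h2 : ∫ x, ψ x • (f x - c) = ∫ x in a..b, ψ x • (f x - c) := by
    symm
    apply intervalIntegral.integral_eq_integral_of_support_subset
    refine Set.Subset.trans ?_ Set.Ioo_subset_Ioc_self
    refine Set.Subset.trans (fun x hx => ?_) hψs
    apply subset_tsupport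
    intro h0
    apply hx
    simp [h0]
  rw [h2]
  have h3 : ∀ x, ψ x • (f x - c) = f x * ψ x - c * ψ x := fun x => by simp only [smul_eq_mul]; ring
  simp_rw [h3]
  rw [intervalIntegral.integral_sub hfψ ((hψ.continuous.intervalIntegrable _ _).const_mul c),
    intervalIntegral.integral_const_mul, ← hd]
  linarith

/-- A function on an interval with integrable weak derivative is a primitive of it. -/
lemma exists_eq_primitive_of_weakDeriv {a b : ℝ} (hab : a < b) {f g : ℝ → ℝ}
    (hf : IntervalIntegrable f volume a b) (hg : IntervalIntegrable g volume a b)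
    (h : ∀ φ : ℝ → ℝ, ContDiff ℝ ∞ φ → HasCompactSupport φ → tsupport φ ⊆ Set.Ioo a b →
      ∫ x in a..b, f x * deriv φ x = -∫ x in a..b, g x * φ x) :
    ∃ c : ℝ, ∀ᵐ x : ℝ, x ∈ Set.Ioo a b → f x = c + ∫ y in a..x, g y := by
  have hac := hg.absolutelyContinuousOnInterval_intervalIntegral (c := a) (by simp)
  have hGi : IntervalIntegrable (fun x => ∫ y in a..x, g y) volume a b :=
    hac.continuousOn.intervalIntegrable
  obtain ⟨c, hc⟩ := exists_const_of_weakDeriv_zero hab (hf.sub hGi) (by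
    intro φ hφ hφc hφs
    have hdφ : Continuous (deriv φ) := hφ.continuous_deriv (by simp)
    have h1 := integral_mul_primitive (A := fun x => ∫ y in a..x, g y) (B := φ) hg
      (hdφ.intervalIntegrable a b) (by simp) (by
        intro x hx
        rw [intervalIntegral.integral_deriv_eq_sub
          (fun y _ => (hφ.differentiable (by simp)).differentiableAt)
          (hdφ.intervalIntegrable a x)]
        ring)
    have hb : φ b = 0 := image_eq_zero_of_notMem_tsupport fun h => by simpa using (hφs h).2
    have h2 := h φ hφ hφc hφs
    simp only [sub_mul]
    rw [intervalIntegral.integral_sub (intervalIntegrable_mul_of_continuous hf hdφ)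
      (intervalIntegrable_mul_of_continuous hGi hdφ), h1, h2, hb]
    simp)
  refine ⟨c, ?_⟩
  filter_upwards [hc] with x hx hx'
  linarith [hx hx']

/-- Fundamental theorem of calculus for a continuous function with integrable weak derivative. -/
lemma sub_eq_integral_of_weakDeriv {a b : ℝ} (hab : a < b) {f g : ℝ → ℝ}
    (hf : ContinuousOn f (Set.Icc a b)) (hg : IntervalIntegrable g volume a b)
    (h : ∀ φ : ℝ → ℝ, ContDiff ℝ ∞ φ → HasCompactSupport φ → tsupport φ ⊆ Set.Ioo a b →
      ∫ x in a..b, f x * deriv φ x = -∫ x in a..b, g x * φ x) :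
    ∀ x ∈ Set.Icc a b, ∀ y ∈ Set.Icc a b, f y - f x = ∫ s in x..y, g s := by
  have hac := hg.absolutelyContinuousOnInterval_intervalIntegral (c := a) (by simp)
  have hfi : IntervalIntegrable f volume a b := by
    apply ContinuousOn.intervalIntegrable
    rwa [Set.uIcc_of_le hab.le]
  obtain ⟨c, hc⟩ := exists_eq_primitive_of_weakDeriv hab hfi hg h
  have hG := hac.continuousOn
  rw [Set.uIcc_of_le hab.le] at hG
  have hIoo : Set.EqOn f (fun x => c + ∫ y in a..x, g y) (Set.Ioo a b) := by
    apply Measure.eqOn_open_of_ae_eq (μ := volume) _ isOpen_Ioo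
      (hf.mono Set.Ioo_subset_Icc_self)
      ((continuousOn_const.add hG).mono Set.Ioo_subset_Icc_self)
    rw [EventuallyEq, ae_restrict_iff' measurableSet_Ioo]
    exact hc
  have hIcc : Set.EqOn f (fun x => c + ∫ y in a..x, g y) (Set.Icc a b) := by
    apply hIoo.of_subset_closure hf (continuousOn_const.add hG) Set.Ioo_subset_Icc_self
    rw [closure_Ioo hab.ne]
  intro x hx y hy
  have hsub : ∀ z ∈ Set.Icc a b, IntervalIntegrable g volume a z := fun z hz =>
    hg.mono_set (by rw [Set.uIcc_of_le hab.le, Set.uIcc_of_le hz.1]; exact Set.Icc_subset_Icc_right hz.2)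
  rw [hIcc hx, hIcc hy, ← intervalIntegral.integral_interval_sub_left (hsub y hy) (hsub x hx)]
  ring

/-! ### Weak derivatives on the line and periodic Sobolev functions. -/

lemma IsWeakDeriv.ae_unique {k : ℕ} {f g g' : ℝ → ℝ} (h : IsWeakDeriv k f g)
    (h' : IsWeakDeriv k f g') : g =ᵐ[volume] g' := by
  apply ae_eq_of_integral_contDiff_smul_eq h.2.1 h'.2.1
  intro φ hφ hφc
  have := (h.2.2 φ hφ hφc).symm.trans (h'.2.2 φ hφ hφc)
  have := mul_left_cancel₀ (pow_ne_zero k (by norm_num : (-1 : ℝ) ≠ 0)) this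
  simpa only [smul_eq_mul, mul_comm] using this

lemma IsWeakDeriv.weakDeriv_ae_eq {k : ℕ} {f g : ℝ → ℝ} (h : IsWeakDeriv k f g) :
    weakDeriv k f =ᵐ[volume] g := by
  have H : ∃ g, IsWeakDeriv k f g := ⟨g, h⟩
  rw [weakDeriv, dif_pos H]
  exact H.choose_spec.ae_unique h

lemma IsWeakDeriv.congr_left {k : ℕ} {f f' g : ℝ → ℝ} (h : IsWeakDeriv k f g)
    (hf : f =ᵐ[volume] f') : IsWeakDeriv k f' g := by
  refine ⟨h.1.congr hf, h.2.1, fun φ hφ hφc => ?_⟩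
  rw [← h.2.2 φ hφ hφc]
  apply integral_congr_ae
  filter_upwards [hf] with x hx
  rw [hx]

lemma IsWeakDeriv.congr_right {k : ℕ} {f g g' : ℝ → ℝ} (h : IsWeakDeriv k f g)
    (hg : g =ᵐ[volume] g') : IsWeakDeriv k f g' := by
  refine ⟨h.1, h.2.1.congr hg, fun φ hφ hφc => ?_⟩
  rw [h.2.2 φ hφ hφc]
  congr 1
  apply integral_congr_ae
  filter_upwards [hg] with x hx
  rw [hx]

lemma isWeakDeriv_zero {f : ℝ → ℝ} (hf : LocallyIntegrable f) : IsWeakDeriv 0 f f :=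
  ⟨hf, hf, fun φ _ _ => by simp⟩

lemma MemHper.congr {m : ℕ} {f f' : ℝ → ℝ} (h : MemHper m f) (hf : f =ᵐ[volume] f') :
    MemHper m f' := by
  refine ⟨?_, fun k hk => ?_⟩
  · have hshift : ∀ᵐ x : ℝ, f (x + 1) = f' (x + 1) :=
      (measurePreserving_add_right volume (1 : ℝ)).quasiMeasurePreserving.ae hf
    filter_upwards [h.1, hf, hshift] with x h1 h2 h3
    rw [← h3, h1, h2]
  · obtain ⟨g, hg, hg2⟩ := h.2 k hk
    exact ⟨g, hg.congr_left hf, hg2⟩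

lemma IsWeakDeriv.intervalIntegrable {k : ℕ} {f g : ℝ → ℝ} (h : IsWeakDeriv k f g) (a b : ℝ) :
    IntervalIntegrable g volume a b :=
  (h.2.1.integrableOn_isCompact isCompact_uIcc).intervalIntegrable

lemma IsWeakDeriv.intervalIntegral_eq {f g : ℝ → ℝ} (h : IsWeakDeriv 1 f g) {a b : ℝ}
    {φ : ℝ → ℝ} (hφ : ContDiff ℝ ∞ φ) (hφc : HasCompactSupport φ)
    (hφs : tsupport φ ⊆ Set.Ioo a b) :
    ∫ x in a..b, f x * deriv φ x = -∫ x in a..b, g x * φ x := by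
  have h1 := h.2.2 φ hφ hφc
  rw [iteratedDeriv_one, pow_one, neg_one_mul] at h1
  rw [intervalIntegral.integral_eq_integral_of_support_subset,
    intervalIntegral.integral_eq_integral_of_support_subset, h1]
  · exact (Function.support_mul_subset_right _ _).trans
      ((subset_tsupport _).trans (hφs.trans Set.Ioo_subset_Ioc_self))
  · exact (Function.support_mul_subset_right _ _).trans
      ((support_deriv_subset).trans (hφs.trans Set.Ioo_subset_Ioc_self))

lemma IsWeakDeriv.sub_eq_integral {f g : ℝ → ℝ} (h : IsWeakDeriv 1 f g) (hf : Continuous f)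
    (x y : ℝ) : f y - f x = ∫ s in x..y, g s := by
  have hlt : -(|x| + |y| + 1) < |x| + |y| + 1 := by
    have := abs_nonneg x; have := abs_nonneg y; linarith
  refine sub_eq_integral_of_weakDeriv hlt hf.continuousOn (h.intervalIntegrable _ _)
    (fun φ hφ hφc hφs => h.intervalIntegral_eq hφ hφc hφs) x ⟨?_, ?_⟩ y ⟨?_, ?_⟩
  all_goals
    linarith [abs_nonneg x, abs_nonneg y, le_abs_self x, le_abs_self y, neg_abs_le x, neg_abs_le y]

/-- A function with a weak derivative has an absolutely continuous representative. -/
lemma IsWeakDeriv.exists_ae_eq_primitive {f g : ℝ → ℝ} (h : IsWeakDeriv 1 f g) :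
    ∃ c : ℝ, f =ᵐ[volume] fun x => c + ∫ s in (0 : ℝ)..x, g s := by
  have key : ∀ n : ℕ, ∃ c : ℝ, ∀ᵐ x : ℝ, x ∈ Set.Ioo (-(n + 1) : ℝ) (n + 1) →
      f x = c + ∫ s in (0 : ℝ)..x, g s := by
    intro n
    obtain ⟨c, hc⟩ := exists_eq_primitive_of_weakDeriv (a := (-(n + 1) : ℝ)) (b := n + 1)
      (by have : (0 : ℝ) ≤ n := n.cast_nonneg
          linarith)
      ((h.1.integrableOn_isCompact isCompact_uIcc).intervalIntegrable)
      (h.intervalIntegrable _ _) (fun φ hφ hφc hφs => h.intervalIntegral_eq hφ hφc hφs)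
    refine ⟨c + ∫ s in (-(n + 1) : ℝ)..0, g s, ?_⟩
    filter_upwards [hc] with x hx hx'
    rw [hx hx', add_assoc, intervalIntegral.integral_add_adjacent_intervals
      (h.intervalIntegrable _ _) (h.intervalIntegrable _ _)]
  choose c hc using key
  -- All the intervals contain `(-1, 1)`, which is not a null set, so the constants agree.
  have hcc : ∀ n, c n = c 0 := by
    intro n
    by_contra hne
    have : ∀ᵐ x : ℝ, x ∉ Set.Ioo (-1 : ℝ) 1 := by
      filter_upwards [hc n, hc 0] with x h1 h2 hx
      apply hne
      have hn : (0 : ℝ) ≤ n := n.cast_nonneg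
      have e1 := h1 ⟨by linarith [hx.1], by linarith [hx.2]⟩
      have e2 := h2 (by simpa using hx)
      linarith
    have h0 := measure_eq_zero_iff_ae_notMem.2 this
    rw [Real.volume_Ioo] at h0
    norm_num at h0
  refine ⟨c 0, ?_⟩
  have hall : ∀ᵐ x : ℝ, ∀ n : ℕ, x ∈ Set.Ioo (-(n + 1) : ℝ) (n + 1) →
      f x = c n + ∫ s in (0 : ℝ)..x, g s := ae_all_iff.2 hc
  filter_upwards [hall] with x hx
  obtain ⟨n, hn⟩ := exists_nat_gt |x|
  have := abs_lt.1 hn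
  rw [hx n ⟨by linarith [this.1], by linarith [this.2]⟩, hcc]

lemma IsWeakDeriv.deriv_of_two {f w z : ℝ → ℝ} (h1 : IsWeakDeriv 1 f w)
    (h2 : IsWeakDeriv 2 f z) : IsWeakDeriv 1 w z := by
  refine ⟨h1.2.1, h2.2.1, fun φ hφ hφc => ?_⟩
  have hφ' : ContDiff ℝ ∞ (deriv φ) := by
    exact (contDiff_infty_iff_deriv.1 hφ).2
  have e1 := h1.2.2 (deriv φ) hφ' hφc.deriv
  have e2 := h2.2.2 φ hφ hφc
  rw [iteratedDeriv_one] at e1 ⊢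
  have : iteratedDeriv 2 φ = deriv (deriv φ) := by
    rw [iteratedDeriv_succ, iteratedDeriv_one]
  rw [this] at e2
  rw [e2] at e1
  linarith

/-- A continuous function in `H²_per` is `C¹`, with absolutely continuous derivative. -/
lemma MemHper.exists_derivs {v : ℝ → ℝ} (h : MemHper 2 v) (hv : Continuous v) :
    ∃ w z : ℝ → ℝ, Continuous w ∧ IsWeakDeriv 1 v w ∧ IsWeakDeriv 2 v z ∧
      MemLp z 2 (volume.restrict (Set.Ioo (0 : ℝ) 1)) ∧
      (∀ x y, w y - w x = ∫ s in x..y, z s) ∧ v 1 = v 0 ∧ w 1 = w 0 := by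
  obtain ⟨w₀, hw₀, -⟩ := h.2 1 (by norm_num)
  obtain ⟨z, hz, hz2⟩ := h.2 2 le_rfl
  have hwz := hw₀.deriv_of_two hz
  obtain ⟨c, hc⟩ := hwz.exists_ae_eq_primitive
  set w : ℝ → ℝ := fun x => c + ∫ s in (0 : ℝ)..x, z s with hw
  have hwc : Continuous w := by
    apply continuous_const.add
    exact intervalIntegral.continuous_primitive (fun a b => hz.intervalIntegrable a b) 0
  have hvw := hw₀.congr_right hc
  have hww : ∀ x y, w y - w x = ∫ s in x..y, z s := by
    intro x y
    rw [hw, ← intervalIntegral.integral_interval_sub_left (hz.intervalIntegrable 0 y)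
      (hz.intervalIntegrable 0 x)]
    ring
  have hper : ∀ x, v (x + 1) = v x := by
    have := Measure.eq_of_ae_eq (μ := (volume : Measure ℝ)) h.1
      (hv.comp (continuous_add_const 1)) hv
    exact fun x => congrFun this x
  have hder : ∀ x, HasDerivAt v (w x) x := by
    intro x
    have e : v = fun y => v 0 + ∫ s in (0 : ℝ)..y, w s := by
      funext y
      linarith [hvw.sub_eq_integral hv 0 y]
    rw [e]
    exact (intervalIntegral.integral_hasDerivAt_right (hwc.intervalIntegrable _ _)
      hwc.stronglyMeasurable.stronglyMeasurableAtFilter hwc.continuousAt).const_add _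
  refine ⟨w, z, hwc, hvw, hz, hz2, hww, by simpa using hper 0, ?_⟩
  -- The derivative of `x ↦ v (x + 1)` at `0` is `w 1`, and this function is `v` itself.
  have h1 : HasDerivAt v (w 1) 0 := by
    have := (hder (0 + 1)).comp_add_const 0 1
    have e : (fun x => v (x + 1)) = v := funext hper
    rwa [e, zero_add] at this
  exact h1.unique (hder 0)

/-! ### Sobolev, Poincaré and interpolation inequalities on the circle. -/

/-- Cauchy-Schwarz against the constant `1` on an interval of length at most one. -/
lemma sq_sub_le_of_sub_eq_integral {v w : ℝ → ℝ}
    (hw : MemLp w 2 (volume.restrict (Set.Ioo (0 : ℝ) 1)))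
    (h : ∀ x y, v y - v x = ∫ s in x..y, w s) {x y : ℝ} (hx : x ∈ Set.Icc (0 : ℝ) 1)
    (hy : y ∈ Set.Icc (0 : ℝ) 1) :
    (v y - v x) ^ 2 ≤ ∫ s in Set.Ioo (0 : ℝ) 1, w s ^ 2 := by
  wlog hxy : x ≤ y generalizing x y
  · have := this hy hx (le_of_not_ge hxy)
    rwa [← neg_sub, neg_sq] at this
  rw [h, intervalIntegral.integral_of_le hxy, integral_Ioc_eq_integral_Ioo]
  have hsub : Set.Ioo x y ⊆ Set.Ioo 0 1 := Set.Ioo_subset_Ioo hx.1 hy.2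
  have hw' : MemLp w 2 (volume.restrict (Set.Ioo x y)) :=
    hw.mono_measure (Measure.restrict_mono hsub le_rfl)
  have h1 : MemLp (fun _ : ℝ => (1 : ℝ)) 2 (volume.restrict (Set.Ioo x y)) := memLp_const 1
  have key := sq_integral_mul_le hw' h1
  simp only [mul_one, one_pow, integral_const, smul_eq_mul, measureReal_restrict_apply_univ,
    Real.volume_real_Ioo_of_le hxy] at key
  have hmono : ∫ s in Set.Ioo x y, w s ^ 2 ≤ ∫ s in Set.Ioo (0 : ℝ) 1, w s ^ 2 :=
    setIntegral_mono_set hw.integrable_sq (Eventually.of_forall fun s => sq_nonneg _)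
      hsub.eventuallyLE
  have h0 : 0 ≤ ∫ s in Set.Ioo x y, w s ^ 2 := integral_nonneg fun s => sq_nonneg _
  nlinarith [hx.1, hy.2]

lemma memLp_Ioo_of_continuous {f : ℝ → ℝ} (hf : Continuous f) (p : ℝ≥0∞) (a b : ℝ) :
    MemLp f p (volume.restrict (Set.Ioo a b)) := by
  obtain ⟨C, hC⟩ := (isCompact_Icc (a := a) (b := b)).exists_bound_of_continuousOn hf.continuousOn
  apply MemLp.of_bound hf.aestronglyMeasurable C
  filter_upwards [ae_restrict_mem measurableSet_Ioo] with x hx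
  exact hC x (Set.Ioo_subset_Icc_self hx)

/-- Interpolation between `L²` and `H²` on the circle. -/
lemma sq_integral_deriv_sq_le {v w z : ℝ → ℝ} (hv : Continuous v) (hw : Continuous w)
    (hz : IntervalIntegrable z volume 0 1)
    (hz2 : MemLp z 2 (volume.restrict (Set.Ioo (0 : ℝ) 1)))
    (hvw : ∀ x y, v y - v x = ∫ s in x..y, w s) (hwz : ∀ x y, w y - w x = ∫ s in x..y, z s)
    (hv1 : v 1 = v 0) (hw1 : w 1 = w 0) (c : ℝ) :
    (∫ s in Set.Ioo (0 : ℝ) 1, w s ^ 2) ^ 2 ≤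
      (∫ s in Set.Ioo (0 : ℝ) 1, (v s - c) ^ 2) * ∫ s in Set.Ioo (0 : ℝ) 1, z s ^ 2 := by
  -- The boundary terms cancel by periodicity, so `∫ w² = -∫ (v - c) z`. The constant `c` is free
  -- because only `v'` and `v''` matter.
  have key := integral_mul_primitive (a := 0) (b := 1) (A := w) (α := z)
    (B := fun x => v x - c) (β := w) hz (hw.intervalIntegrable _ _)
    (fun x _ => by linarith [hwz 0 x]) (fun x _ => by linarith [hvw 0 x])
  rw [hv1, hw1, sub_self, zero_sub, intervalIntegral.integral_of_le zero_le_one,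
    intervalIntegral.integral_of_le zero_le_one, integral_Ioc_eq_integral_Ioo,
    integral_Ioc_eq_integral_Ioo] at key
  have h1 : ∫ s in Set.Ioo (0 : ℝ) 1, w s ^ 2 = -∫ s in Set.Ioo (0 : ℝ) 1, (v s - c) * z s := by
    simp_rw [pow_two, key, mul_comm]
  rw [h1, neg_sq]
  exact sq_integral_mul_le (memLp_Ioo_of_continuous (hv.sub continuous_const) 2 0 1) hz2

/-- Interpolation with `c = v 0` gives `‖w‖⁴ ≤ ‖v - v 0‖² ‖z‖²`. The oscillation estimate bounds `‖v
- v 0‖²` by `‖w‖²`, and one factor `‖w‖²` cancels. -/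
lemma integral_deriv_sq_le {v w z : ℝ → ℝ} (hv : Continuous v) (hw : Continuous w)
    (hz : IntervalIntegrable z volume 0 1)
    (hz2 : MemLp z 2 (volume.restrict (Set.Ioo (0 : ℝ) 1)))
    (hvw : ∀ x y, v y - v x = ∫ s in x..y, w s) (hwz : ∀ x y, w y - w x = ∫ s in x..y, z s)
    (hv1 : v 1 = v 0) (hw1 : w 1 = w 0) :
    ∫ s in Set.Ioo (0 : ℝ) 1, w s ^ 2 ≤ ∫ s in Set.Ioo (0 : ℝ) 1, z s ^ 2 := by
  have h1 := sq_integral_deriv_sq_le hv hw hz hz2 hvw hwz hv1 hw1 (v 0)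
  have h2 : ∫ s in Set.Ioo (0 : ℝ) 1, (v s - v 0) ^ 2 ≤ ∫ s in Set.Ioo (0 : ℝ) 1, w s ^ 2 := by
    have : ∫ s in Set.Ioo (0 : ℝ) 1, (v s - v 0) ^ 2
        ≤ ∫ _ in Set.Ioo (0 : ℝ) 1, (∫ s in Set.Ioo (0 : ℝ) 1, w s ^ 2) := by
      apply setIntegral_mono_on
      · exact (memLp_Ioo_of_continuous (hv.sub continuous_const) 2 0 1).integrable_sq
      · exact integrable_const _
      · exact measurableSet_Ioo
      · intro x hx
        exact sq_sub_le_of_sub_eq_integral (memLp_Ioo_of_continuous hw 2 0 1) hvw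
          (by simp) (Set.Ioo_subset_Icc_self hx)
    simpa using this
  have hA : 0 ≤ ∫ s in Set.Ioo (0 : ℝ) 1, w s ^ 2 := integral_nonneg fun s => sq_nonneg _
  have hB : 0 ≤ ∫ s in Set.Ioo (0 : ℝ) 1, z s ^ 2 := integral_nonneg fun s => sq_nonneg _
  rcases hA.eq_or_lt with h0 | h0
  · rw [← h0]; exact hB
  · nlinarith

lemma lintegral_enorm_sq_eq {α : Type*} [MeasurableSpace α] {μ : Measure α} {f : α → ℝ}
    (hf : MemLp f 2 μ) : ∫⁻ x, ‖f x‖ₑ ^ 2 ∂μ = ENNReal.ofReal (∫ x, f x ^ 2 ∂μ) := by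
  rw [ofReal_integral_eq_lintegral_ofReal hf.integrable_sq
    (Eventually.of_forall fun x => sq_nonneg _)]
  congr 1
  ext x
  rw [← sq_abs, ENNReal.ofReal_pow (abs_nonneg _), ← Real.norm_eq_abs, ofReal_norm]

/-- `weakDeriv` is an arbitrary choice within its almost everywhere class; this allows the norm to
be computed from any representative. -/
lemma hperNorm_one_eq {f w : ℝ → ℝ} (hf : Continuous f)
    (hper : ∀ᵐ h : ℝ, f (h + 1) = f h) (hw : IsWeakDeriv 1 f w)
    (hw2 : MemLp w 2 (volume.restrict (Set.Ioo (0 : ℝ) 1))) :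
    hperNorm 1 f = ENNReal.ofReal (√((∫ s in Set.Ioo (0 : ℝ) 1, f s ^ 2)
      + ∫ s in Set.Ioo (0 : ℝ) 1, w s ^ 2)) := by
  have hf2 := memLp_Ioo_of_continuous hf 2 0 1
  have h0 := isWeakDeriv_zero hf.locallyIntegrable
  have hmem : MemHper 1 f := by
    refine ⟨hper, fun k hk => ?_⟩
    interval_cases k
    · exact ⟨f, h0, hf2⟩
    · exact ⟨w, hw, hw2⟩
  rw [hperNorm, if_pos hmem, Finset.sum_range_succ, Finset.sum_range_one]
  have e0 : ∫⁻ h in Set.Ioo (0 : ℝ) 1, ‖weakDeriv 0 f h‖ₑ ^ 2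
      = ∫⁻ h in Set.Ioo (0 : ℝ) 1, ‖f h‖ₑ ^ 2 := by
    apply lintegral_congr_ae
    filter_upwards [ae_restrict_of_ae h0.weakDeriv_ae_eq] with x hx
    rw [hx]
  have e1 : ∫⁻ h in Set.Ioo (0 : ℝ) 1, ‖weakDeriv 1 f h‖ₑ ^ 2
      = ∫⁻ h in Set.Ioo (0 : ℝ) 1, ‖w h‖ₑ ^ 2 := by
    apply lintegral_congr_ae
    filter_upwards [ae_restrict_of_ae hw.weakDeriv_ae_eq] with x hx
    rw [hx]
  have n0 : 0 ≤ ∫ s in Set.Ioo (0 : ℝ) 1, f s ^ 2 := integral_nonneg fun s => sq_nonneg _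
  have n1 : 0 ≤ ∫ s in Set.Ioo (0 : ℝ) 1, w s ^ 2 := integral_nonneg fun s => sq_nonneg _
  rw [e0, e1, lintegral_enorm_sq_eq hf2, lintegral_enorm_sq_eq hw2,
    ← ENNReal.ofReal_add n0 n1, ENNReal.ofReal_rpow_of_nonneg (add_nonneg n0 n1) (by norm_num),
    Real.sqrt_eq_rpow]

lemma exists_le_integral_Ioo {f : ℝ → ℝ} (hf : IntegrableOn f (Set.Ioo (0 : ℝ) 1)) :
    ∃ y ∈ Set.Ioo (0 : ℝ) 1, f y ≤ ∫ s in Set.Ioo (0 : ℝ) 1, f s := by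
  obtain ⟨y, hy, h⟩ := exists_le_setAverage (by simp) (by simp) hf
  refine ⟨y, hy, h.trans_eq ?_⟩
  rw [setAverage_eq]
  simp

lemma exists_integral_Ioo_le {f : ℝ → ℝ} (hf : IntegrableOn f (Set.Ioo (0 : ℝ) 1)) :
    ∃ y ∈ Set.Ioo (0 : ℝ) 1, ∫ s in Set.Ioo (0 : ℝ) 1, f s ≤ f y := by
  obtain ⟨y, hy, h⟩ := exists_setAverage_le (by simp) (by simp) hf
  refine ⟨y, hy, Eq.trans_le ?_ h⟩
  rw [setAverage_eq]
  simp

/-- The Sobolev embedding of `H¹_per` into the bounded functions. -/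
lemma abs_le_two_mul_hperNorm {f : ℝ → ℝ} (hf : Continuous f) (hfin : hperNorm 1 f ≠ ⊤)
    {x : ℝ} (hx : x ∈ Set.Icc (0 : ℝ) 1) : |f x| ≤ 2 * (hperNorm 1 f).toReal := by
  have hmem : MemHper 1 f := by
    by_contra hcon
    exact hfin (by rw [hperNorm, if_neg hcon])
  obtain ⟨w, hw, hw2⟩ := hmem.2 1 le_rfl
  have hf2 := memLp_Ioo_of_continuous hf 2 0 1
  rw [hperNorm_one_eq hf hmem.1 hw hw2, ENNReal.toReal_ofReal (Real.sqrt_nonneg _)]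
  set a := ∫ s in Set.Ioo (0 : ℝ) 1, f s ^ 2 with ha
  set A := ∫ s in Set.Ioo (0 : ℝ) 1, w s ^ 2 with hA
  have n0 : 0 ≤ a := integral_nonneg fun s => sq_nonneg _
  have n1 : 0 ≤ A := integral_nonneg fun s => sq_nonneg _
  -- At `y` the value `f y ^ 2` is at most its mean. The oscillation from `y` to `x` costs the norm
  -- once more, which gives the factor `2`.
  obtain ⟨y, hy, hya⟩ := exists_le_integral_Ioo hf2.integrable_sq
  have h1 := sq_sub_le_of_sub_eq_integral hw2 (hw.sub_eq_integral hf)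
    (Set.Ioo_subset_Icc_self hy) hx
  have h2 : |f y| ≤ √(a + A) := by
    rw [← Real.sqrt_sq_eq_abs]
    exact Real.sqrt_le_sqrt (by linarith)
  have h3 : |f x - f y| ≤ √(a + A) := by
    rw [← Real.sqrt_sq_eq_abs]
    exact Real.sqrt_le_sqrt (by linarith)
  have := abs_add_le (f x - f y) (f y)
  rw [sub_add_cancel] at this
  linarith

lemma IsWeakDeriv.sub_const {f w : ℝ → ℝ} (h : IsWeakDeriv 1 f w) (c : ℝ) :
    IsWeakDeriv 1 (fun x => f x - c) w := by
  refine ⟨h.1.sub (continuous_const.locallyIntegrable), h.2.1, fun φ hφ hφc => ?_⟩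
  rw [← h.2.2 φ hφ hφc, iteratedDeriv_one]
  have hd : Continuous (deriv φ) := hφ.continuous_deriv (by simp)
  have hi : Integrable (deriv φ) := hd.integrable_of_hasCompactSupport hφc.deriv
  have hz : ∫ x, deriv φ x = 0 :=
    integral_eq_zero_of_hasDerivAt_of_integrable
      (fun x => ((hφ.differentiable (by simp)).differentiableAt).hasDerivAt) hi
      (hφ.continuous.integrable_of_hasCompactSupport hφc)
  have hfi : Integrable (fun x => f x * deriv φ x) := by
    simpa only [smul_eq_mul, mul_comm] using
      h.1.integrable_smul_left_of_hasCompactSupport hd hφc.deriv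
  simp_rw [sub_mul]
  rw [integral_sub hfi (hi.const_mul c), integral_const_mul, hz, mul_zero, sub_zero]

/-- The cube root is 1/3-Hölder on the half line; this is how estimates on `u³` pass to `u`. -/
lemma pow_three_abs_sub_le {a b : ℝ} (ha : 0 ≤ a) (hb : 0 ≤ b) :
    |a - b| ^ 3 ≤ |a ^ 3 - b ^ 3| := by
  wlog hab : b ≤ a generalizing a b
  · rw [abs_sub_comm, abs_sub_comm (a ^ 3)]
    exact this hb ha (le_of_not_ge hab)
  rw [abs_of_nonneg (sub_nonneg.2 hab),
    abs_of_nonneg (sub_nonneg.2 (pow_le_pow_left₀ hb hab 3))]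
  nlinarith [mul_nonneg (mul_nonneg ha hb) (sub_nonneg.2 hab)]

/-! ### Deviation from the mean and spatial estimates. -/

/-- The mean over one period. -/
noncomputable def mean (f : ℝ → ℝ) : ℝ := ∫ h in Set.Ioo (0 : ℝ) 1, f h

/-- The square of the `L²` distance between the cube of `f` and the cube of its mean. -/
noncomputable def cubeDeviation (f : ℝ → ℝ) : ℝ :=
  ∫ h in Set.Ioo (0 : ℝ) 1, (f h ^ 3 - mean f ^ 3) ^ 2

lemma cubeDeviation_nonneg (f : ℝ → ℝ) : 0 ≤ cubeDeviation f :=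
  integral_nonneg fun _ => sq_nonneg _

/-- Spatial estimates for a function of finite energy; `A` and `B` are the squares of the `L²` norms
of the first two derivatives of the cube. -/
lemma exists_bounds_of_energy {f : ℝ → ℝ} (hf : Continuous f) (hf0 : ∀ x, 0 ≤ f x)
    (hE : energy f ≠ ⊤) :
    ∃ A B : ℝ, 0 ≤ A ∧ A ≤ B ∧ ENNReal.ofReal B = 6 * energy f ∧
      (∀ x ∈ Set.Icc (0 : ℝ) 1, ∀ y ∈ Set.Icc (0 : ℝ) 1, (f y ^ 3 - f x ^ 3) ^ 2 ≤ A) ∧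
      (∀ x ∈ Set.Icc (0 : ℝ) 1, (f x ^ 3 - mean f ^ 3) ^ 2 ≤ A) ∧
      cubeDeviation f ≤ A ∧ A ^ 2 ≤ cubeDeviation f * B ∧
      ∀ c, hperNorm 1 (fun h => f h ^ 3 - c) =
        ENNReal.ofReal (√((∫ h in Set.Ioo (0 : ℝ) 1, (f h ^ 3 - c) ^ 2) + A)) := by
  have hmem : MemHper 2 (fun h => f h ^ 3) := by
    by_contra hcon
    exact hE (by rw [energy, if_neg hcon])
  have hv : Continuous (fun h => f h ^ 3) := hf.pow 3
  obtain ⟨w, z, hwc, hw, hz, hz2, hwz, hv1, hw1⟩ := hmem.exists_derivs hv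
  have hvw := hw.sub_eq_integral hv
  have hw2 := memLp_Ioo_of_continuous hwc 2 0 1
  have hosc : ∀ x ∈ Set.Icc (0 : ℝ) 1, ∀ y ∈ Set.Icc (0 : ℝ) 1,
      (f y ^ 3 - f x ^ 3) ^ 2 ≤ ∫ s in Set.Ioo (0 : ℝ) 1, w s ^ 2 := fun x hx y hy =>
    sq_sub_le_of_sub_eq_integral hw2 hvw hx hy
  -- `mean f ^ 3` need not be the mean of `f ^ 3`, but it lies between two values `f y₁ ^ 3` and `f
  -- y₂ ^ 3`, so the oscillation bound still applies.
  have hmean : ∀ x ∈ Set.Icc (0 : ℝ) 1,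
      (f x ^ 3 - mean f ^ 3) ^ 2 ≤ ∫ s in Set.Ioo (0 : ℝ) 1, w s ^ 2 := by
    intro x hx
    have hint : IntegrableOn f (Set.Ioo (0 : ℝ) 1) :=
      (memLp_Ioo_of_continuous hf 1 0 1).integrable le_rfl
    obtain ⟨y₁, hy₁, h₁⟩ := exists_le_integral_Ioo hint
    obtain ⟨y₂, hy₂, h₂⟩ := exists_integral_Ioo_le hint
    have e₁ := hosc _ (Set.Ioo_subset_Icc_self hy₁) x hx
    have e₂ := hosc _ (Set.Ioo_subset_Icc_self hy₂) x hx
    have k₁ : f y₁ ^ 3 ≤ mean f ^ 3 := pow_le_pow_left₀ (hf0 _) h₁ 3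
    have k₂ : mean f ^ 3 ≤ f y₂ ^ 3 := pow_le_pow_left₀ ((hf0 _).trans h₁) h₂ 3
    rcases le_total (mean f ^ 3) (f x ^ 3) with h | h
    · refine le_trans ?_ e₁
      exact pow_le_pow_left₀ (sub_nonneg.2 h) (by linarith) 2
    · refine le_trans ?_ e₂
      rw [← neg_sub, neg_sq, ← neg_sub (f y₂ ^ 3), neg_sq]
      exact pow_le_pow_left₀ (sub_nonneg.2 h) (by linarith) 2
  refine ⟨∫ s in Set.Ioo (0 : ℝ) 1, w s ^ 2, ∫ s in Set.Ioo (0 : ℝ) 1, z s ^ 2,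
    integral_nonneg fun _ => sq_nonneg _,
    integral_deriv_sq_le hv hwc (hz.intervalIntegrable _ _) hz2 hvw hwz hv1 hw1, ?_, hosc, hmean,
    ?_, sq_integral_deriv_sq_le hv hwc (hz.intervalIntegrable _ _) hz2 hvw hwz hv1 hw1 _, ?_⟩
  · rw [energy, if_pos hmem, ← mul_assoc, ENNReal.mul_inv_cancel (by simp) (by simp), one_mul,
      ← lintegral_enorm_sq_eq hz2]
    apply lintegral_congr_ae
    filter_upwards [ae_restrict_of_ae hz.weakDeriv_ae_eq] with x hx
    rw [hx]
  · have := setIntegral_mono_on (μ := volume) (s := Set.Ioo (0 : ℝ) 1)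
      (memLp_Ioo_of_continuous (hv.sub (continuous_const (y := mean f ^ 3))) 2 0 1).integrable_sq
      (integrable_const _) measurableSet_Ioo
      (fun x hx => hmean x (Set.Ioo_subset_Icc_self hx))
    simpa [cubeDeviation] using this
  · intro c
    apply hperNorm_one_eq (hv.sub continuous_const) _ (hw.sub_const c) hw2
    filter_upwards [hmem.1] with x hx
    simp only [Pi.sub_apply, hx]

lemma energy_ne_top_of_memHper {f : ℝ → ℝ} (h : MemHper 2 (fun x => f x ^ 3)) :
    energy f ≠ ⊤ := by
  obtain ⟨g, hg, hg2⟩ := h.2 2 le_rfl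
  rw [energy, if_pos h]
  have e : ∫⁻ x in Set.Ioo (0 : ℝ) 1, ‖weakDeriv 2 (fun x => f x ^ 3) x‖ₑ ^ 2
      = ∫⁻ x in Set.Ioo (0 : ℝ) 1, ‖g x‖ₑ ^ 2 := by
    apply lintegral_congr_ae
    filter_upwards [ae_restrict_of_ae hg.weakDeriv_ae_eq] with x hx
    rw [hx]
  rw [e, lintegral_enorm_sq_eq hg2]
  exact ENNReal.mul_ne_top (by simp) ENNReal.ofReal_ne_top

/-! ### Bounds and continuity of global solutions. -/

variable {u : ℝ → ℝ → ℝ} {u₀ : ℝ → ℝ}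

namespace IsGlobalWeakSolution

lemma nonneg (hu : IsGlobalWeakSolution u u₀) {t : ℝ} (ht : 0 ≤ t) (h : ℝ) : 0 ≤ u t h :=
  (hu (t + 1) (by linarith)).nonneg t ⟨ht, by linarith⟩ h

lemma continuous_slice (hu : IsGlobalWeakSolution u u₀) {t : ℝ} (ht : 0 ≤ t) :
    Continuous (u t) :=
  (hu (t + 1) (by linarith)).continuous_slice t ⟨ht, by linarith⟩

lemma periodic (hu : IsGlobalWeakSolution u u₀) {t : ℝ} (ht : 0 ≤ t) :
    Function.Periodic (u t) 1 := by
  have hv := (hu.continuous_slice ht).pow 3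
  have := Measure.eq_of_ae_eq (μ := (volume : Measure ℝ))
    ((hu (t + 1) (by linarith)).cube_mem_H1 t ⟨ht, by linarith⟩).1
    (hv.comp (continuous_add_const 1)) hv
  intro x
  exact (Odd.strictMono_pow (by decide : Odd 3)).injective (congrFun this x)

lemma energy_zero_ne_top (hu : IsGlobalWeakSolution u u₀) (hu₀ : MemHper 2 (fun h => u₀ h ^ 3)) :
    energy (u 0) ≠ ⊤ := by
  apply energy_ne_top_of_memHper
  apply hu₀.congr
  filter_upwards [(hu 1 one_pos).initial] with x hx
  rw [hx]

/-- Each `t > 0` is the final time of a solution on `[0,t]`, so the bound holds at every time,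
whereas the `L^∞` in time condition controls only almost every time. -/
lemma energy_le (hu : IsGlobalWeakSolution u u₀) {t : ℝ} (ht : 0 ≤ t) :
    energy (u t) ≤ energy (u 0) := by
  rcases ht.eq_or_lt with rfl | ht
  · rfl
  · obtain ⟨ut, g, -, -, -, -, -, h⟩ := (hu t ht).equation
    exact le_self_add.trans h

lemma freeEnergy_le (hu : IsGlobalWeakSolution u u₀) {t : ℝ} (ht : 0 ≤ t) :
    freeEnergy (u t) ≤ freeEnergy (u 0) := by
  rcases ht.eq_or_lt with rfl | ht
  · rfl
  · exact le_self_add.trans (hu t ht).second_dissipation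

lemma freeEnergy_eq (hu : IsGlobalWeakSolution u u₀) {t : ℝ} (ht : 0 ≤ t) :
    freeEnergy (u t) = 2⁻¹ * ENNReal.ofReal (∫ h in Set.Ioo (0 : ℝ) 1, u t h ^ 2) := by
  rw [freeEnergy, lintegral_enorm_sq_eq (memLp_Ioo_of_continuous (hu.continuous_slice ht) 2 0 1)]

lemma integral_sq_le (hu : IsGlobalWeakSolution u u₀) {t : ℝ} (ht : 0 ≤ t) :
    ∫ h in Set.Ioo (0 : ℝ) 1, u t h ^ 2 ≤ ∫ h in Set.Ioo (0 : ℝ) 1, u 0 h ^ 2 := by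
  have h := hu.freeEnergy_le ht
  rw [hu.freeEnergy_eq ht, hu.freeEnergy_eq le_rfl,
    ENNReal.mul_le_mul_iff_right (by simp) (by simp)] at h
  exact (ENNReal.ofReal_le_ofReal_iff (integral_nonneg fun _ => sq_nonneg _)).1 h

/-- The spatial estimates hold at all times with a common bound on the second derivative. -/
lemma exists_bounds (hu : IsGlobalWeakSolution u u₀) (hu₀ : MemHper 2 (fun h => u₀ h ^ 3)) :
    ∃ K : ℝ, 0 ≤ K ∧ ∀ t : ℝ, 0 ≤ t → ∃ A : ℝ, 0 ≤ A ∧ A ≤ K ∧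
      ENNReal.ofReal A ≤ 6 * energy (u t) ∧
      (∀ x ∈ Set.Icc (0 : ℝ) 1, ∀ y ∈ Set.Icc (0 : ℝ) 1, (u t y ^ 3 - u t x ^ 3) ^ 2 ≤ A) ∧
      (∀ x ∈ Set.Icc (0 : ℝ) 1, (u t x ^ 3 - mean (u t) ^ 3) ^ 2 ≤ A) ∧
      cubeDeviation (u t) ≤ A ∧ A ^ 2 ≤ cubeDeviation (u t) * K ∧
      ∀ c, hperNorm 1 (fun h => u t h ^ 3 - c) =
        ENNReal.ofReal (√((∫ h in Set.Ioo (0 : ℝ) 1, (u t h ^ 3 - c) ^ 2) + A)) := by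
  have htop := hu.energy_zero_ne_top hu₀
  have htop6 : 6 * energy (u 0) ≠ ⊤ := ENNReal.mul_ne_top (by simp) htop
  refine ⟨(6 * energy (u 0)).toReal, ENNReal.toReal_nonneg, fun t ht => ?_⟩
  obtain ⟨A, B, hA, hAB, hB, h1, h2, h3, h4, h5⟩ :=
    exists_bounds_of_energy (hu.continuous_slice ht) (hu.nonneg ht)
      (ne_top_of_le_ne_top htop (hu.energy_le ht))
  have hBK : B ≤ (6 * energy (u 0)).toReal := by
    rw [← ENNReal.ofReal_le_iff_le_toReal htop6, hB]
    gcongr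
    exact hu.energy_le ht
  refine ⟨A, hA, hAB.trans hBK, ?_, h1, h2, h3, h4.trans ?_, h5⟩
  · rw [← hB]
    exact ENNReal.ofReal_le_ofReal hAB
  · exact mul_le_mul_of_nonneg_left hBK (cubeDeviation_nonneg _)

lemma exists_eq_fract (hu : IsGlobalWeakSolution u u₀) (h : ℝ) :
    ∃ x ∈ Set.Icc (0 : ℝ) 1, ∀ t, 0 ≤ t → u t h = u t x :=
  ⟨Int.fract h, ⟨Int.fract_nonneg h, (Int.fract_lt_one h).le⟩, fun t ht => by
    have := (hu.periodic ht).sub_int_mul_eq (x := h) ⌊h⌋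
    rw [mul_one] at this
    exact this.symm⟩

lemma exists_upper_bound (hu : IsGlobalWeakSolution u u₀) (hu₀ : MemHper 2 (fun h => u₀ h ^ 3)) :
    ∃ M : ℝ, 0 < M ∧ ∀ t, 0 ≤ t → ∀ h, u t h ≤ M := by
  obtain ⟨K, hK, hb⟩ := hu.exists_bounds hu₀
  set F := ∫ h in Set.Ioo (0 : ℝ) 1, u 0 h ^ 2 with hF
  have hF0 : 0 ≤ F := integral_nonneg fun _ => sq_nonneg _
  -- Since `r ≤ r² + 1`, some `u t y` is at most `F + 1` and the oscillation of `u³` is at most `K +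
  -- 1`. Finally `u ≤ 1 + u³`.
  refine ⟨1 + (F + 1) ^ 3 + (K + 1), by positivity, fun t ht h => ?_⟩
  obtain ⟨x, hx, hxe⟩ := hu.exists_eq_fract h
  rw [hxe t ht]
  obtain ⟨A, hA, hAK, -, hosc, -⟩ := hb t ht
  obtain ⟨y, hy, hyF⟩ := exists_le_integral_Ioo
    (memLp_Ioo_of_continuous (hu.continuous_slice ht) 2 0 1).integrable_sq
  have h1 := hosc y (Set.Ioo_subset_Icc_self hy) x hx
  have h2 : u t y ≤ F + 1 := by
    have := hyF.trans (hu.integral_sq_le ht)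
    nlinarith [sq_nonneg (u t y - 1)]
  have h3 : u t y ^ 3 ≤ (F + 1) ^ 3 := pow_le_pow_left₀ (hu.nonneg ht y) h2 3
  have h4 : u t x ^ 3 - u t y ^ 3 ≤ K + 1 := by
    nlinarith [sq_nonneg (u t x ^ 3 - u t y ^ 3 - 1)]
  have h5 : 0 ≤ u t x := hu.nonneg ht x
  have h6 : u t x ≤ 1 + u t x ^ 3 := by
    nlinarith [mul_nonneg h5 (sq_nonneg (u t x - 1)), sq_nonneg (u t x - 1)]
  linarith

/-- The solution is continuous in time, uniformly in space. -/
lemma eventually_abs_sub_le (hu : IsGlobalWeakSolution u u₀) {s : ℝ} (hs : 0 ≤ s) {ε : ℝ}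
    (hε : 0 < ε) : ∀ᶠ t in 𝓝[Set.Ici 0] s, ∀ h, |u t h - u s h| ≤ ε := by
  have hT := hu (s + 1) (by linarith)
  have hmem : Set.Icc 0 (s + 1) ∈ 𝓝[Set.Ici 0] s := by
    rw [← Set.Ici_inter_Iic]
    exact inter_mem self_mem_nhdsWithin (mem_nhdsWithin_of_mem_nhds (Iic_mem_nhds (by linarith)))
  have hten := hT.cube_continuous_H1 s ⟨hs, by linarith⟩
  -- The `2` is the Sobolev constant and the cube is undone by the 1/3-Hölder bound for the cube
  -- root.
  have hlt := hten.eventually_lt_const (u := ENNReal.ofReal (ε ^ 3 / 2))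
    (ENNReal.ofReal_pos.2 (by positivity))
  have hle : 𝓝[Set.Ici 0] s ≤ 𝓝[Set.Icc 0 (s + 1)] s :=
    nhdsWithin_le_iff.2 hmem
  filter_upwards [hle hlt, self_mem_nhdsWithin] with t ht ht0 h
  obtain ⟨x, hx, hxe⟩ := hu.exists_eq_fract h
  rw [hxe t ht0, hxe s hs]
  have h1 := abs_le_two_mul_hperNorm
    (((hu.continuous_slice ht0).pow 3).sub ((hu.continuous_slice hs).pow 3)) ht.ne_top hx
  have h2 : (hperNorm 1 fun h => u t h ^ 3 - u s h ^ 3).toReal ≤ ε ^ 3 / 2 := by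
    apply ENNReal.toReal_le_of_le_ofReal (by positivity) ht.le
  have h3 := pow_three_abs_sub_le (hu.nonneg ht0 x) (hu.nonneg hs x)
  have h4 : |u t x - u s x| ^ 3 ≤ ε ^ 3 := by
    refine h3.trans (h1.trans ?_)
    have : 2 * (hperNorm 1 fun h => u t h ^ 3 - u s h ^ 3).toReal ≤ ε ^ 3 := by linarith
    exact this
  exact le_of_pow_le_pow_left₀ (by norm_num) hε.le h4

lemma continuousOn (hu : IsGlobalWeakSolution u u₀) :
    ContinuousOn (fun p : ℝ × ℝ => u p.1 p.2) (Set.Ici 0 ×ˢ Set.univ) := by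
  rintro ⟨s, x⟩ ⟨hs, -⟩
  have hs : 0 ≤ s := hs
  rw [ContinuousWithinAt, Metric.tendsto_nhds]
  intro ε hε
  rw [nhdsWithin_prod_eq, nhdsWithin_univ]
  have h1 := hu.eventually_abs_sub_le hs (half_pos (half_pos hε))
  have h2 : ∀ᶠ y in 𝓝 x, dist (u s y) (u s x) < ε / 2 :=
    (Metric.tendsto_nhds.1 (hu.continuous_slice hs).continuousAt) (ε / 2) (half_pos hε)
  filter_upwards [h1.prod_mk h2] with p hp
  rw [Real.dist_eq] at hp ⊢
  have e1 := hp.1 p.2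
  have e2 := hp.2
  have := abs_sub_le (u p.1 p.2) (u s p.2) (u s x)
  simp only at *
  linarith

end IsGlobalWeakSolution

/-! ### The equation almost everywhere. -/

/-- A smooth function supported in the interior of a period extends periodically. -/
lemma contDiff_comp_fract {φ : ℝ × ℝ → ℝ} (hφ : ContDiff ℝ ∞ φ) {I : Set ℝ}
    (hs : tsupport φ ⊆ I ×ˢ Set.Ioo (0 : ℝ) 1) :
    ContDiff ℝ ∞ (fun p : ℝ × ℝ => φ (p.1, Int.fract p.2)) := by
  rw [contDiff_iff_contDiffAt]
  rintro ⟨t, x⟩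
  have hshift : ∀ n : ℤ, ContDiff ℝ ∞ (fun p : ℝ × ℝ => φ (p.1, p.2 - n)) := fun n =>
    hφ.comp (contDiff_fst.prodMk (contDiff_snd.sub contDiff_const))
  -- At an integer the fractional part jumps from near `1` to `0`, but `φ` vanishes near both `(t,
  -- 0)` and `(t, 1)`.
  by_cases hx : x = ⌊x⌋
  · have hz : ∀ y : ℝ, y ∉ Set.Ioo (0 : ℝ) 1 → ∀ n : ℤ, x - n = y →
        ∀ᶠ p in 𝓝 (t, x), φ (p.1, p.2 - n) = 0 := by
      intro y hy n hn
      have h1 : (t, y) ∉ tsupport φ := fun h => hy (hs h).2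
      rw [notMem_tsupport_iff_eventuallyEq] at h1
      have h2 : Tendsto (fun p : ℝ × ℝ => (p.1, p.2 - (n : ℝ))) (𝓝 (t, x)) (𝓝 (t, y)) := by
        rw [← hn]
        exact (continuous_fst.prodMk (continuous_snd.sub continuous_const)).tendsto (t, x)
      exact h2.eventually h1
    have h0 := hz 0 (by simp) ⌊x⌋ (by linarith)
    have h1 := hz 1 (by simp) (⌊x⌋ - 1) (by push_cast; linarith)
    have hnear : ∀ᶠ p : ℝ × ℝ in 𝓝 (t, x), p.2 ∈ Set.Ioo (x - 1) (x + 1) :=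
      continuous_snd.continuousAt.eventually (Ioo_mem_nhds (by simp) (by simp))
    apply (contDiffAt_const (c := (0 : ℝ))).congr_of_eventuallyEq
    filter_upwards [h0, h1, hnear] with p h0 h1 hp
    rcases lt_or_ge p.2 x with h | h
    · have : ⌊p.2⌋ = ⌊x⌋ - 1 := by
        rw [Int.floor_eq_iff]
        push_cast
        exact ⟨by linarith [hp.1], by linarith⟩
      rw [Int.fract, this]
      exact h1
    · have : ⌊p.2⌋ = ⌊x⌋ := by
        rw [Int.floor_eq_iff]
        exact ⟨by linarith, by linarith [hp.2]⟩
      rw [Int.fract, this]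
      exact h0
  · apply (hshift ⌊x⌋).contDiffAt.congr_of_eventuallyEq
    have hlt : (⌊x⌋ : ℝ) < x := lt_of_le_of_ne (Int.floor_le x) (Ne.symm hx)
    have hnear : ∀ᶠ p : ℝ × ℝ in 𝓝 (t, x), p.2 ∈ Set.Ioo (⌊x⌋ : ℝ) (⌊x⌋ + 1) :=
      continuous_snd.continuousAt.eventually (Ioo_mem_nhds hlt (Int.lt_floor_add_one x))
    filter_upwards [hnear] with p hp
    have : ⌊p.2⌋ = ⌊x⌋ := by
      rw [Int.floor_eq_iff]
      exact ⟨hp.1.le, hp.2⟩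
    rw [Int.fract, this]

lemma volume_restrict_Ioo_prod (s t : ℝ) :
    (volume : Measure (ℝ × ℝ)).restrict (Set.Ioo s t ×ˢ Set.Ioo (0 : ℝ) 1) =
      (volume.restrict (Set.Ioo s t)).prod (volume.restrict (Set.Ioo (0 : ℝ) 1)) := by
  rw [Measure.volume_eq_prod, Measure.prod_restrict]

lemma periodPositiveSet_eq (T : ℝ) :
    periodPositiveSet T u = positiveSet T u ∩ (Set.Ioo 0 T ×ˢ Set.Ioo (0 : ℝ) 1) := by
  ext p
  simp only [periodPositiveSet, positiveSet, Set.mem_inter_iff, Set.mem_prod, Set.mem_ofPred_eq]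
  tauto

namespace IsGlobalWeakSolution

lemma isOpen_positiveSet (hu : IsGlobalWeakSolution u u₀) (T : ℝ) :
    IsOpen (positiveSet T u) := by
  have h1 : ContinuousOn (fun p : ℝ × ℝ => u p.1 p.2) (Set.Ioo 0 T ×ˢ Set.univ) :=
    hu.continuousOn.mono (Set.prod_mono (fun x hx => hx.1.le) le_rfl)
  have h2 := h1.isOpen_inter_preimage (isOpen_Ioo.prod isOpen_univ)
    (isOpen_compl_singleton (x := (0 : ℝ)))
  convert! h2 using 1
  ext p
  simp [positiveSet]

lemma measurableSet_periodPositiveSet (hu : IsGlobalWeakSolution u u₀) (T : ℝ) :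
    MeasurableSet (periodPositiveSet T u) := by
  rw [periodPositiveSet_eq]
  exact (hu.isOpen_positiveSet T).measurableSet.inter (measurableSet_Ioo.prod measurableSet_Ioo)

/-- The equation holds almost everywhere, and `u_t` is square integrable with a bound that does not
depend on the time. -/
lemma exists_timeDeriv (hu : IsGlobalWeakSolution u u₀) (hu₀ : MemHper 2 (fun h => u₀ h ^ 3))
    {T : ℝ} (hT : 0 < T) :
    ∃ ut g : ℝ × ℝ → ℝ,
      IsWeakDt (Set.Ioo 0 T ×ˢ Set.univ) (fun p => u p.1 p.2) ut ∧
      MemLp ut 2 (volume.restrict (Set.Ioo 0 T ×ˢ Set.Ioo (0 : ℝ) 1)) ∧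
      IsWeakDhhhh (positiveSet T u) (fun p => u p.1 p.2 ^ 3) g ∧
      (∀ᵐ p, p ∈ periodPositiveSet T u → ut p = -(u p.1 p.2 ^ 2 * g p)) ∧
      ∫ p in Set.Ioo 0 T ×ˢ Set.Ioo (0 : ℝ) 1, ut p ^ 2 ≤ (energy (u 0)).toReal := by
  obtain ⟨ut, g, hut, hut2, hg, hg2, heq, hE⟩ := (hu T hT).equation
  set Ω : Set (ℝ × ℝ) := Set.Ioo 0 T ×ˢ Set.Ioo (0 : ℝ) 1 with hΩ
  set P := periodPositiveSet T u with hP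
  have hPm : MeasurableSet P := hu.measurableSet_periodPositiveSet T
  have hΩm : MeasurableSet Ω := measurableSet_Ioo.prod measurableSet_Ioo
  have hPΩ : P ⊆ Ω := by
    rw [hP, periodPositiveSet_eq]
    exact Set.inter_subset_right
  have hfin : IsFiniteMeasure (volume.restrict Ω) := by
    rw [hΩ, volume_restrict_Ioo_prod]
    infer_instance
  -- Extension by zero puts both terms of the weak equation on the whole of `Ω`, so the fundamental
  -- lemma also yields `ut = 0` almost everywhere in `Ω` off `P`.
  set q : ℝ × ℝ → ℝ := P.indicator (fun p => u p.1 p.2 ^ 2 * g p) with hq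
  have hq2 : MemLp q 2 (volume.restrict Ω) := by
    have h1 : MemLp q 2 volume := (memLp_indicator_iff_restrict hPm).2 hg2
    exact h1.mono_measure Measure.restrict_le_self
  have hG2 : MemLp (fun p => ut p + q p) 2 (volume.restrict Ω) := hut2.add hq2
  have hGi : IntegrableOn (fun p => ut p + q p) Ω := hG2.integrable (by norm_num)
  have hint : ∀ φ : ℝ × ℝ → ℝ, ∫ p in P, φ p * (u p.1 p.2 ^ 2 * g p) = ∫ p in Ω, φ p * q p := by
    intro φ
    have e : ∀ p, φ p * q p = P.indicator (fun p => φ p * (u p.1 p.2 ^ 2 * g p)) p := by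
      intro p
      by_cases hp : p ∈ P <;> simp [hq, hp]
    simp_rw [e]
    rw [setIntegral_indicator hPm, Set.inter_eq_right.2 hPΩ]
  have hzero : ∀ᵐ p, p ∈ Ω → ut p + q p = 0 := by
    apply IsOpen.ae_eq_zero_of_integral_contDiff_smul_eq_zero (isOpen_Ioo.prod isOpen_Ioo)
      hGi.locallyIntegrableOn
    intro φ hφ hφc hφs
    -- The weak equation only admits periodic test functions, hence the periodic extension of `φ`.
    have hper := heq (fun p => φ (p.1, Int.fract p.2)) (contDiff_comp_fract hφ hφs).contDiffOn
      (fun t _ h => by simp)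
    rw [hint] at hper
    have hfract : ∀ p ∈ Ω, φ (p.1, Int.fract p.2) = φ p := by
      intro p hp
      rw [Int.fract_eq_self.2 ⟨hp.2.1.le, hp.2.2⟩]
    have e1 : ∫ p in Ω, φ (p.1, Int.fract p.2) * ut p = ∫ p in Ω, φ p * ut p :=
      setIntegral_congr_fun hΩm fun p hp => by simp only [hfract p hp]
    have e2 : ∫ p in Ω, φ (p.1, Int.fract p.2) * q p = ∫ p in Ω, φ p * q p :=
      setIntegral_congr_fun hΩm fun p hp => by simp only [hfract p hp]
    rw [e1, e2] at hper
    obtain ⟨C, hC⟩ := hφ.continuous.bounded_above_of_compact_support hφc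
    have i1 : Integrable (fun p => φ p * ut p) (volume.restrict Ω) :=
      (hut2.integrable (by norm_num)).bdd_mul hφ.continuous.aestronglyMeasurable
        (Eventually.of_forall hC)
    have i2 : Integrable (fun p => φ p * q p) (volume.restrict Ω) :=
      (hq2.integrable (by norm_num)).bdd_mul hφ.continuous.aestronglyMeasurable
        (Eventually.of_forall hC)
    rw [← setIntegral_eq_integral_of_forall_compl_eq_zero (s := Ω)]
    · simp only [smul_eq_mul, mul_add]
      rw [integral_add i1 i2, hper]
    · intro p hp
      rw [image_eq_zero_of_notMem_tsupport fun h => hp (hφs h), zero_smul]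
  refine ⟨ut, g, hut, hut2, hg, ?_, ?_⟩
  · filter_upwards [hzero] with p hp hpP
    have := hp (hPΩ hpP)
    rw [hq, Set.indicator_of_mem hpP] at this
    linarith
  · have htop := hu.energy_zero_ne_top hu₀
    -- Because `ut` vanishes off `P`, its full `L²` norm is the quantity that the dissipation of `E`
    -- controls.
    have e1 : ∫ p in Ω, ut p ^ 2 = ∫ p in P, (u p.1 p.2 ^ 2 * g p) ^ 2 := by
      have e : ∫ p in Ω, ut p ^ 2
          = ∫ p in Ω, P.indicator (fun p => (u p.1 p.2 ^ 2 * g p) ^ 2) p := by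
        apply setIntegral_congr_ae hΩm
        filter_upwards [hzero] with p hp hpΩ
        have h1 : ut p = -q p := by linarith [hp hpΩ]
        rw [h1, neg_sq, hq]
        by_cases hpP : p ∈ P <;> simp [hpP]
      rw [e, setIntegral_indicator hPm, Set.inter_eq_right.2 hPΩ]
    rw [e1, ← ENNReal.ofReal_le_iff_le_toReal htop, ← lintegral_enorm_sq_eq hg2]
    exact le_add_self.trans hE

end IsGlobalWeakSolution

/-! ### Increments in time. -/

lemma tsupport_tensor_subset (χ ψ : ℝ → ℝ) :
    tsupport (fun p : ℝ × ℝ => χ p.1 * ψ p.2) ⊆ tsupport χ ×ˢ tsupport ψ := by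
  apply closure_minimal _ ((isClosed_tsupport χ).prod (isClosed_tsupport ψ))
  intro p hp
  exact ⟨subset_tsupport _ (left_ne_zero_of_mul hp), subset_tsupport _ (right_ne_zero_of_mul hp)⟩

lemma hasCompactSupport_tensor {χ ψ : ℝ → ℝ} (hχ : HasCompactSupport χ)
    (hψ : HasCompactSupport ψ) : HasCompactSupport (fun p : ℝ × ℝ => χ p.1 * ψ p.2) :=
  (hχ.isCompact.prod hψ.isCompact).of_isClosed_subset (isClosed_tsupport _)
    (tsupport_tensor_subset χ ψ)

lemma contDiff_tensor {χ ψ : ℝ → ℝ} (hχ : ContDiff ℝ ∞ χ) (hψ : ContDiff ℝ ∞ ψ) :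
    ContDiff ℝ ∞ (fun p : ℝ × ℝ => χ p.1 * ψ p.2) :=
  (hχ.comp contDiff_fst).mul (hψ.comp contDiff_snd)

instance isFiniteMeasure_restrict_Ioo_prod (s t : ℝ) :
    IsFiniteMeasure ((volume : Measure (ℝ × ℝ)).restrict (Set.Ioo s t ×ˢ Set.Ioo (0 : ℝ) 1)) := by
  rw [volume_restrict_Ioo_prod]
  infer_instance

lemma integrableOn_mul_continuous_snd {s t : ℝ} {f : ℝ × ℝ → ℝ} {w : ℝ → ℝ}
    (hf : IntegrableOn f (Set.Ioo s t ×ˢ Set.Ioo (0 : ℝ) 1)) (hw : Continuous w) :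
    IntegrableOn (fun p => w p.2 * f p) (Set.Ioo s t ×ˢ Set.Ioo (0 : ℝ) 1) := by
  obtain ⟨C, hC⟩ := (isCompact_Icc (a := (0 : ℝ)) (b := 1)).exists_bound_of_continuousOn
    hw.continuousOn
  apply Integrable.bdd_mul (c := C) hf (hw.comp continuous_snd).aestronglyMeasurable
  filter_upwards [ae_restrict_mem (measurableSet_Ioo.prod measurableSet_Ioo)] with p hp
  exact hC p.2 (Set.Ioo_subset_Icc_self hp.2)

lemma IsWeakDt.integral_tensor {T : ℝ} {f ut : ℝ × ℝ → ℝ}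
    (hut : IsWeakDt (Set.Ioo 0 T ×ˢ Set.univ) f ut)
    {χ ψ : ℝ → ℝ} (hχ : ContDiff ℝ ∞ χ) (hχc : HasCompactSupport χ)
    (hχs : tsupport χ ⊆ Set.Ioo 0 T) (hψ : ContDiff ℝ ∞ ψ) (hψc : HasCompactSupport ψ)
    (hψs : tsupport ψ ⊆ Set.Ioo 0 1) :
    ∫ p in Set.Ioo 0 T ×ˢ Set.Ioo (0 : ℝ) 1, ψ p.2 * f p * deriv χ p.1
      = -∫ p in Set.Ioo 0 T ×ˢ Set.Ioo (0 : ℝ) 1, ψ p.2 * ut p * χ p.1 := by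
  have h := hut.2.2 _ (contDiff_tensor hχ hψ) (hasCompactSupport_tensor hχc hψc)
    ((tsupport_tensor_subset χ ψ).trans (Set.prod_mono hχs (Set.subset_univ _)))
  have hd : ∀ p : ℝ × ℝ, deriv (fun s => χ s * ψ p.2) p.1 = deriv χ p.1 * ψ p.2 := fun p =>
    deriv_mul_const (hχ.differentiable (by simp)).differentiableAt _
  simp only [hd] at h
  have hz : ∀ p ∈ (Set.Ioo 0 T ×ˢ Set.univ) \ (Set.Ioo 0 T ×ˢ Set.Ioo (0 : ℝ) 1), ψ p.2 = 0 := by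
    intro p hp
    apply image_eq_zero_of_notMem_tsupport
    exact fun hcon => hp.2 ⟨hp.1.1, hψs hcon⟩
  have hsub : Set.Ioo 0 T ×ˢ Set.Ioo (0 : ℝ) 1 ⊆ Set.Ioo 0 T ×ˢ Set.univ :=
    Set.prod_mono le_rfl (Set.subset_univ _)
  have hm : MeasurableSet (Set.Ioo 0 T ×ˢ (Set.univ : Set ℝ)) :=
    measurableSet_Ioo.prod MeasurableSet.univ
  rw [setIntegral_eq_of_subset_of_forall_sdiff_eq_zero hm hsub,
    setIntegral_eq_of_subset_of_forall_sdiff_eq_zero hm hsub] at h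
  · have e1 : ∀ p : ℝ × ℝ, ψ p.2 * f p * deriv χ p.1 = f p * (deriv χ p.1 * ψ p.2) := fun p => by
      ring
    have e2 : ∀ p : ℝ × ℝ, ψ p.2 * ut p * χ p.1 = ut p * (χ p.1 * ψ p.2) := fun p => by ring
    simp only [e1, e2]
    exact h
  · intro p hp; rw [hz p hp]; ring
  · intro p hp; rw [hz p hp]; ring

namespace IsGlobalWeakSolution

/-- Increments in time, tested against a smooth function. -/
lemma integral_sub_mul_test (hu : IsGlobalWeakSolution u u₀)
    (hu₀ : MemHper 2 (fun h => u₀ h ^ 3)) {T : ℝ} (hT : 0 < T) {ut : ℝ × ℝ → ℝ}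
    (hut : IsWeakDt (Set.Ioo 0 T ×ˢ Set.univ) (fun p => u p.1 p.2) ut)
    (hut1 : IntegrableOn ut (Set.Ioo 0 T ×ˢ Set.Ioo (0 : ℝ) 1)) {s t : ℝ} (hs : 0 ≤ s)
    (hst : s ≤ t) (htT : t ≤ T) {ψ : ℝ → ℝ} (hψ : ContDiff ℝ ∞ ψ) (hψc : HasCompactSupport ψ)
    (hψs : tsupport ψ ⊆ Set.Ioo 0 1) :
    ∫ x in Set.Ioo (0 : ℝ) 1, ψ x * (u t x - u s x) =
      ∫ x in Set.Ioo (0 : ℝ) 1, ψ x * ∫ τ in Set.Ioo s t, ut (τ, x) := by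
  obtain ⟨M, hM, hub⟩ := hu.exists_upper_bound hu₀
  have hψL := memLp_Ioo_of_continuous hψ.continuous 1 0 1
  have hψi : IntegrableOn ψ (Set.Ioo (0 : ℝ) 1) := hψL.integrable le_rfl
  set a : ℝ → ℝ := fun τ => ∫ x in Set.Ioo (0 : ℝ) 1, ψ x * u τ x with ha
  set b : ℝ → ℝ := fun τ => ∫ x in Set.Ioo (0 : ℝ) 1, ψ x * ut (τ, x) with hb
  have hac : ContinuousOn a (Set.Icc 0 T) := by
    apply continuousOn_of_dominated (bound := fun x => |ψ x| * M)
    · intro τ hτ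
      exact (hψ.continuous.mul (hu.continuous_slice hτ.1)).aestronglyMeasurable
    · intro τ hτ
      refine Eventually.of_forall fun x => ?_
      rw [Real.norm_eq_abs, abs_mul, abs_of_nonneg (hu.nonneg hτ.1 x)]
      exact mul_le_mul_of_nonneg_left (hub τ hτ.1 x) (abs_nonneg _)
    · exact hψi.abs.mul_const M
    · refine Eventually.of_forall fun x => continuousOn_const.mul ?_
      exact hu.continuousOn.comp (continuousOn_id.prodMk continuousOn_const)
        (fun τ hτ => ⟨hτ.1, Set.mem_univ _⟩)
  have hut' := integrableOn_mul_continuous_snd hut1 hψ.continuous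
  have hut'' := hut'
  rw [IntegrableOn, volume_restrict_Ioo_prod] at hut''
  have hbi : IntervalIntegrable b volume 0 T := by
    rw [intervalIntegrable_iff_integrableOn_Ioo_of_le hT.le]
    exact hut''.integral_prod_left
  -- Test functions `χ(τ) ψ(x)` show that `b` is the weak derivative of the continuous function `a`.
  have key := sub_eq_integral_of_weakDeriv hT hac hbi (by
    intro χ hχ hχc hχs
    have h := hut.integral_tensor hχ hχc hχs hψ hψc hψs
    have hdχ : Continuous (deriv χ) := hχ.continuous_deriv (by simp)
    obtain ⟨C, hC⟩ := hχ.continuous.bounded_above_of_compact_support hχc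
    obtain ⟨C', hC'⟩ := hdχ.bounded_above_of_compact_support hχc.deriv
    have i2 : IntegrableOn (fun p => ψ p.2 * ut p * χ p.1)
        (Set.Ioo 0 T ×ˢ Set.Ioo (0 : ℝ) 1) :=
      Integrable.mul_bdd (c := C) hut' (hχ.continuous.comp continuous_fst).aestronglyMeasurable
        (Eventually.of_forall fun p => hC p.1)
    have hum : AEStronglyMeasurable (fun p : ℝ × ℝ => u p.1 p.2)
        (volume.restrict (Set.Ioo 0 T ×ˢ Set.Ioo (0 : ℝ) 1)) :=
      (hu.continuousOn.mono (Set.prod_mono (fun x hx => hx.1.le)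
        (Set.subset_univ _))).aestronglyMeasurable (measurableSet_Ioo.prod measurableSet_Ioo)
    have i0 : IntegrableOn (fun p : ℝ × ℝ => u p.1 p.2) (Set.Ioo 0 T ×ˢ Set.Ioo (0 : ℝ) 1) := by
      apply Integrable.of_bound hum M
      filter_upwards [ae_restrict_mem (measurableSet_Ioo.prod measurableSet_Ioo)] with p hp
      rw [Real.norm_eq_abs, abs_of_nonneg (hu.nonneg hp.1.1.le _)]
      exact hub _ hp.1.1.le _
    have i1 : IntegrableOn (fun p => ψ p.2 * u p.1 p.2 * deriv χ p.1)
        (Set.Ioo 0 T ×ˢ Set.Ioo (0 : ℝ) 1) :=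
      Integrable.mul_bdd (c := C') (integrableOn_mul_continuous_snd i0 hψ.continuous)
        (hdχ.comp continuous_fst).aestronglyMeasurable
        (Eventually.of_forall fun p => hC' p.1)
    rw [IntegrableOn, volume_restrict_Ioo_prod] at i1 i2
    rw [volume_restrict_Ioo_prod, integral_prod _ i1, integral_prod _ i2] at h
    simp only [integral_mul_const] at h
    rw [intervalIntegral.integral_of_le hT.le, intervalIntegral.integral_of_le hT.le,
      integral_Ioc_eq_integral_Ioo, integral_Ioc_eq_integral_Ioo]
    exact h)
  have h1 := key s ⟨hs, hst.trans htT⟩ t ⟨hs.trans hst, htT⟩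
  have hi : ∀ τ, 0 ≤ τ → IntegrableOn (fun x => ψ x * u τ x) (Set.Ioo (0 : ℝ) 1) := fun τ hτ =>
    (memLp_Ioo_of_continuous (hψ.continuous.mul (hu.continuous_slice hτ)) 1 0 1).integrable le_rfl
  simp only [mul_sub]
  rw [integral_sub (hi t (hs.trans hst)) (hi s hs)]
  refine h1.trans ?_
  have hsub : Set.Ioo s t ×ˢ Set.Ioo (0 : ℝ) 1 ⊆ Set.Ioo 0 T ×ˢ Set.Ioo (0 : ℝ) 1 :=
    Set.prod_mono (Set.Ioo_subset_Ioo hs htT) le_rfl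
  have i3 := hut'.mono_set hsub
  rw [IntegrableOn, volume_restrict_Ioo_prod] at i3
  rw [intervalIntegral.integral_of_le hst, integral_Ioc_eq_integral_Ioo, hb,
    integral_integral_swap i3]
  simp only [integral_const_mul]

/-- Increments in time, tested against a continuous function. -/
lemma integral_mul_sub_eq (hu : IsGlobalWeakSolution u u₀)
    (hu₀ : MemHper 2 (fun h => u₀ h ^ 3)) {T : ℝ} (hT : 0 < T) {ut : ℝ × ℝ → ℝ}
    (hut : IsWeakDt (Set.Ioo 0 T ×ˢ Set.univ) (fun p => u p.1 p.2) ut)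
    (hut1 : IntegrableOn ut (Set.Ioo 0 T ×ˢ Set.Ioo (0 : ℝ) 1)) {s t : ℝ} (hs : 0 ≤ s)
    (hst : s ≤ t) (htT : t ≤ T) {w : ℝ → ℝ} (hw : Continuous w) :
    ∫ x in Set.Ioo (0 : ℝ) 1, w x * (u t x - u s x) =
      ∫ p in Set.Ioo s t ×ˢ Set.Ioo (0 : ℝ) 1, w p.2 * ut p := by
  have hsub : Set.Ioo s t ×ˢ Set.Ioo (0 : ℝ) 1 ⊆ Set.Ioo 0 T ×ˢ Set.Ioo (0 : ℝ) 1 :=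
    Set.prod_mono (Set.Ioo_subset_Ioo hs htT) le_rfl
  have hi := hut1.mono_set hsub
  have hwi := integrableOn_mul_continuous_snd hi hw
  rw [IntegrableOn, volume_restrict_Ioo_prod] at hi hwi
  have hI : IntegrableOn (fun x => ∫ τ in Set.Ioo s t, ut (τ, x)) (Set.Ioo (0 : ℝ) 1) :=
    hi.integral_prod_right
  have hd : IntegrableOn (fun x => u t x - u s x) (Set.Ioo (0 : ℝ) 1) :=
    (memLp_Ioo_of_continuous ((hu.continuous_slice (hs.trans hst)).sub
      (hu.continuous_slice hs)) 1 0 1).integrable le_rfl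
  have hD : IntegrableOn (fun x => (u t x - u s x) - ∫ τ in Set.Ioo s t, ut (τ, x))
      (Set.Ioo (0 : ℝ) 1) := hd.sub hI
  -- Since `ψ` is arbitrary, `u t x - u s x = ∫ ut (τ, x) dτ` for almost every `x`; any continuous
  -- weight may then be inserted.
  have hae := isOpen_Ioo.ae_eq_zero_of_integral_contDiff_smul_eq_zero hD.locallyIntegrableOn (by
    intro ψ hψ hψc hψs
    obtain ⟨C, hC⟩ := hψ.continuous.bounded_above_of_compact_support hψc
    rw [← setIntegral_eq_integral_of_forall_compl_eq_zero (s := Set.Ioo (0 : ℝ) 1)]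
    · simp only [smul_eq_mul, mul_sub]
      have := hu.integral_sub_mul_test hu₀ hT hut hut1 hs hst htT hψ hψc hψs
      have i1 : IntegrableOn (fun x => ψ x * (u t x - u s x)) (Set.Ioo (0 : ℝ) 1) :=
        Integrable.bdd_mul hd hψ.continuous.aestronglyMeasurable (Eventually.of_forall hC)
      have i2 : IntegrableOn (fun x => ψ x * ∫ τ in Set.Ioo s t, ut (τ, x)) (Set.Ioo (0 : ℝ) 1) :=
        Integrable.bdd_mul hI hψ.continuous.aestronglyMeasurable (Eventually.of_forall hC)
      simp only [← mul_sub]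
      have e : ∀ x, ψ x * ((u t x - u s x) - ∫ τ in Set.Ioo s t, ut (τ, x))
          = ψ x * (u t x - u s x) - ψ x * ∫ τ in Set.Ioo s t, ut (τ, x) := fun x => mul_sub _ _ _
      simp only [e]
      rw [integral_sub i1 i2, this, sub_self]
    · intro x hx
      rw [image_eq_zero_of_notMem_tsupport fun h => hx (hψs h), zero_smul])
  rw [volume_restrict_Ioo_prod, integral_prod_symm _ hwi]
  simp only [integral_const_mul]
  apply setIntegral_congr_ae measurableSet_Ioo
  filter_upwards [hae] with x hx hx'
  rw [sub_eq_zero.1 (hx hx')]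

lemma mean_sub_eq (hu : IsGlobalWeakSolution u u₀)
    (hu₀ : MemHper 2 (fun h => u₀ h ^ 3)) {T : ℝ} (hT : 0 < T) {ut : ℝ × ℝ → ℝ}
    (hut : IsWeakDt (Set.Ioo 0 T ×ˢ Set.univ) (fun p => u p.1 p.2) ut)
    (hut1 : IntegrableOn ut (Set.Ioo 0 T ×ˢ Set.Ioo (0 : ℝ) 1)) {s t : ℝ} (hs : 0 ≤ s)
    (hst : s ≤ t) (htT : t ≤ T) :
    mean (u t) - mean (u s) = ∫ p in Set.Ioo s t ×ˢ Set.Ioo (0 : ℝ) 1, ut p := by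
  have h := hu.integral_mul_sub_eq hu₀ hT hut hut1 hs hst htT (continuous_const (y := (1 : ℝ)))
  simp only [one_mul] at h
  rw [← h, mean, mean, integral_sub]
  · exact (memLp_Ioo_of_continuous (hu.continuous_slice (hs.trans hst)) 1 0 1).integrable le_rfl
  · exact (memLp_Ioo_of_continuous (hu.continuous_slice hs) 1 0 1).integrable le_rfl

/-- The solution is Hölder continuous in time with values in `L²`. -/
lemma integral_sq_sub_le (hu : IsGlobalWeakSolution u u₀)
    (hu₀ : MemHper 2 (fun h => u₀ h ^ 3)) {s t : ℝ} (hs : 0 ≤ s) (hst : s ≤ t) :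
    ∫ x in Set.Ioo (0 : ℝ) 1, (u t x - u s x) ^ 2 ≤ (t - s) * (energy (u 0)).toReal := by
  have hT : 0 < t + 1 := by linarith
  obtain ⟨ut, g, hut, hut2, -, -, hE⟩ := hu.exists_timeDeriv hu₀ hT
  have hwc : Continuous (fun x => u t x - u s x) :=
    (hu.continuous_slice (hs.trans hst)).sub (hu.continuous_slice hs)
  -- The increment is tested against itself. With `W` its squared `L²` norm, Cauchy-Schwarz gives
  -- `W² ≤ (t - s) W E(u(0))`.
  have h := hu.integral_mul_sub_eq hu₀ hT hut (hut2.integrable (by norm_num)) hs hst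
    (by linarith) hwc
  have hsub : Set.Ioo s t ×ˢ Set.Ioo (0 : ℝ) 1 ⊆ Set.Ioo 0 (t + 1) ×ˢ Set.Ioo (0 : ℝ) 1 :=
    Set.prod_mono (Set.Ioo_subset_Ioo hs (by linarith)) le_rfl
  have hut2' : MemLp ut 2 (volume.restrict (Set.Ioo s t ×ˢ Set.Ioo (0 : ℝ) 1)) :=
    hut2.mono_measure (Measure.restrict_mono hsub le_rfl)
  have hw2 : MemLp (fun p : ℝ × ℝ => u t p.2 - u s p.2) 2
      (volume.restrict (Set.Ioo s t ×ˢ Set.Ioo (0 : ℝ) 1)) := by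
    rw [volume_restrict_Ioo_prod]
    exact (memLp_Ioo_of_continuous hwc 2 0 1).comp_snd _
  have hcs := sq_integral_mul_le hw2 hut2'
  rw [← h] at hcs
  have e1 : ∫ p in Set.Ioo s t ×ˢ Set.Ioo (0 : ℝ) 1, (u t p.2 - u s p.2) ^ 2
      = (t - s) * ∫ x in Set.Ioo (0 : ℝ) 1, (u t x - u s x) ^ 2 := by
    rw [volume_restrict_Ioo_prod]
    rw [integral_fun_snd (fun x => (u t x - u s x) ^ 2)]
    simp [hst]
  have e2 : ∫ p in Set.Ioo s t ×ˢ Set.Ioo (0 : ℝ) 1, ut p ^ 2 ≤ (energy (u 0)).toReal :=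
    (setIntegral_mono_set hut2.integrable_sq (Eventually.of_forall fun _ => sq_nonneg _)
      hsub.eventuallyLE).trans hE
  have e3 : ∀ x, (u t x - u s x) * (u t x - u s x) = (u t x - u s x) ^ 2 := fun x => (sq _).symm
  simp only [e3] at hcs
  rw [e1] at hcs
  set W := ∫ x in Set.Ioo (0 : ℝ) 1, (u t x - u s x) ^ 2 with hW
  have hW0 : 0 ≤ W := integral_nonneg fun _ => sq_nonneg _
  have hts : 0 ≤ t - s := sub_nonneg.2 hst
  have hcs' : W ^ 2 ≤ (t - s) * W * (energy (u 0)).toReal :=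
    hcs.trans (mul_le_mul_of_nonneg_left e2 (mul_nonneg hts hW0))
  rcases hW0.eq_or_lt with h0 | h0
  · rw [← h0]
    exact mul_nonneg hts ENNReal.toReal_nonneg
  · nlinarith

end IsGlobalWeakSolution

/-! ### Decay of the deviation. -/

/-- An integrable, uniformly Hölder continuous function on the half line tends to zero; its integral
over late intervals is uniformly small. -/
lemma tendsto_zero_of_integrable_of_holder {f : ℝ → ℝ} {C L : ℝ} (hf0 : ∀ t, 0 ≤ f t)
    (hfc : ContinuousOn f (Set.Ici 0))
    (hfi : ∀ T, 0 < T → ∫ t in Set.Ioo 0 T, f t ≤ C) (hL0 : 0 ≤ L)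
    (hL : ∀ s t, 0 ≤ s → s ≤ t → |f t - f s| ≤ L * √(t - s)) :
    Tendsto f atTop (𝓝 0) ∧ ∃ R : ℝ → ℝ, Tendsto R atTop (𝓝 0) ∧
      ∀ s t, 0 ≤ s → s ≤ t → ∫ τ in Set.Ioo s t, f τ ≤ R s := by
  have hii : ∀ s t, 0 ≤ s → 0 ≤ t → IntervalIntegrable f volume s t := fun s t hs ht =>
    (hfc.mono (fun x hx => (le_min hs ht).trans hx.1)).intervalIntegrable
  have hIoi : IntegrableOn f (Set.Ioi 0) := by
    apply integrableOn_Ioi_of_intervalIntegral_norm_bounded (l := atTop) (b := fun T : ℝ => T) C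
    · intro T
      rcases le_total 0 T with hT | hT
      · exact (intervalIntegrable_iff_integrableOn_Ioc_of_le hT).1 (hii 0 T le_rfl hT)
      · simp [hT]
    · exact tendsto_id
    · filter_upwards [eventually_gt_atTop 0] with T hT
      have : ∀ x, ‖f x‖ = f x := fun x => by rw [Real.norm_eq_abs, abs_of_nonneg (hf0 x)]
      simp only [this]
      rw [intervalIntegral.integral_of_le hT.le, integral_Ioc_eq_integral_Ioo]
      exact hfi T hT
  have hten := intervalIntegral_tendsto_integral_Ioi 0 hIoi tendsto_id
  set R : ℝ → ℝ := fun s => (∫ t in Set.Ioi 0, f t) - ∫ t in (0 : ℝ)..s, f t with hR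
  have hRt : Tendsto R atTop (𝓝 0) := by
    have := (tendsto_const_nhds (x := ∫ t in Set.Ioi 0, f t)).sub hten
    rwa [sub_self] at this
  have hRb : ∀ s t, 0 ≤ s → s ≤ t → ∫ τ in Set.Ioo s t, f τ ≤ R s := by
    intro s t hs hst
    have h1 : ∫ τ in Set.Ioo s t, f τ = (∫ τ in (0 : ℝ)..t, f τ) - ∫ τ in (0 : ℝ)..s, f τ := by
      rw [← integral_Ioc_eq_integral_Ioo, ← intervalIntegral.integral_of_le hst,
        intervalIntegral.integral_interval_sub_left (hii 0 t le_rfl (hs.trans hst))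
          (hii 0 s le_rfl hs)]
    have h2 : ∫ τ in (0 : ℝ)..t, f τ ≤ ∫ τ in Set.Ioi 0, f τ := by
      rw [intervalIntegral.integral_of_le (hs.trans hst)]
      exact setIntegral_mono_set hIoi (Eventually.of_forall hf0)
        Set.Ioc_subset_Ioi_self.eventuallyLE
    rw [h1, hR]
    linarith
  refine ⟨?_, R, hRt, hRb⟩
  rw [Metric.tendsto_nhds]
  intro ε hε
  -- On a time interval of length `η` the function drops by at most `ε / 2`. Hence `η (f t - ε / 2)`
  -- is at most the tail `R t`, which is eventually below `η ε / 2`.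
  set η : ℝ := (ε / (2 * (L + 1))) ^ 2 with hη
  have hη0 : 0 < η := by positivity
  have hLη : L * √η ≤ ε / 2 := by
    rw [hη, Real.sqrt_sq (by positivity), ← mul_div_assoc, div_le_div_iff₀ (by positivity) two_pos]
    nlinarith
  filter_upwards [hRt.eventually_lt_const (u := η * (ε / 2)) (by positivity),
    eventually_ge_atTop 0] with t ht ht0
  rw [Real.dist_eq, sub_zero, abs_of_nonneg (hf0 t)]
  have h1 : ∫ τ in Set.Ioo t (t + η), f τ ≤ R t := hRb t (t + η) ht0 (by linarith)
  have h2 : ∫ _ in Set.Ioo t (t + η), (f t - ε / 2) ≤ ∫ τ in Set.Ioo t (t + η), f τ := by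
    apply setIntegral_mono_on
    · exact integrable_const _
    · exact (intervalIntegrable_iff_integrableOn_Ioo_of_le (by linarith)).1
        (hii t (t + η) ht0 (by linarith))
    · exact measurableSet_Ioo
    · intro τ hτ
      have h3 := hL t τ ht0 hτ.1.le
      have h4 : L * √(τ - t) ≤ L * √η :=
        mul_le_mul_of_nonneg_left (Real.sqrt_le_sqrt (by linarith [hτ.2])) hL0
      linarith [neg_abs_le (f τ - f t)]
  have h3 : ∫ _ in Set.Ioo t (t + η), (f t - ε / 2) = η * (f t - ε / 2) := by
    rw [setIntegral_const, Real.volume_real_Ioo_of_le (by linarith), smul_eq_mul]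
    ring
  rw [h3] at h2
  have h4 : η * (f t - ε / 2) < η * (ε / 2) := by linarith
  have := lt_of_mul_lt_mul_left h4 hη0.le
  linarith

namespace IsGlobalWeakSolution

lemma integrableOn_slice (hu : IsGlobalWeakSolution u u₀) {t : ℝ} (ht : 0 ≤ t) :
    IntegrableOn (u t) (Set.Ioo (0 : ℝ) 1) :=
  (memLp_Ioo_of_continuous (hu.continuous_slice ht) 1 0 1).integrable le_rfl

lemma mean_mem_Icc (hu : IsGlobalWeakSolution u u₀) {M t : ℝ} (ht : 0 ≤ t)
    (hM : ∀ t, 0 ≤ t → ∀ h, u t h ≤ M) : mean (u t) ∈ Set.Icc 0 M := by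
  refine ⟨integral_nonneg (hu.nonneg ht), ?_⟩
  obtain ⟨y, -, hy⟩ := exists_integral_Ioo_le (hu.integrableOn_slice ht)
  exact hy.trans (hM t ht y)

lemma integral_abs_sub_le (hu : IsGlobalWeakSolution u u₀)
    (hu₀ : MemHper 2 (fun h => u₀ h ^ 3)) {s t : ℝ} (hs : 0 ≤ s) (hst : s ≤ t) :
    ∫ x in Set.Ioo (0 : ℝ) 1, |u t x - u s x| ≤ √(energy (u 0)).toReal * √(t - s) := by
  have hc : Continuous (fun x => |u t x - u s x|) :=
    ((hu.continuous_slice (hs.trans hst)).sub (hu.continuous_slice hs)).abs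
  have h := sq_integral_mul_le (memLp_Ioo_of_continuous hc 2 0 1)
    (memLp_const (1 : ℝ) (μ := volume.restrict (Set.Ioo (0 : ℝ) 1)))
  simp only [mul_one, sq_abs, one_pow, integral_const, smul_eq_mul, measureReal_restrict_apply_univ,
    Real.volume_real_Ioo_of_le zero_le_one, sub_zero] at h
  have h2 := h.trans (hu.integral_sq_sub_le hu₀ hs hst)
  rw [← Real.sqrt_mul ENNReal.toReal_nonneg]
  apply Real.le_sqrt_of_sq_le
  linarith

lemma abs_mean_sub_le (hu : IsGlobalWeakSolution u u₀) {s t : ℝ} (hs : 0 ≤ s) (ht : 0 ≤ t) :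
    |mean (u t) - mean (u s)| ≤ ∫ x in Set.Ioo (0 : ℝ) 1, |u t x - u s x| := by
  rw [mean, mean, ← integral_sub (hu.integrableOn_slice ht) (hu.integrableOn_slice hs)]
  exact abs_integral_le_integral_abs

lemma continuousOn_mean (hu : IsGlobalWeakSolution u u₀)
    (hu₀ : MemHper 2 (fun h => u₀ h ^ 3)) :
    ContinuousOn (fun t => mean (u t)) (Set.Ici 0) := by
  obtain ⟨M, hM, hub⟩ := hu.exists_upper_bound hu₀
  apply continuousOn_of_dominated (bound := fun _ => M)
  · intro t ht
    exact (hu.continuous_slice ht).aestronglyMeasurable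
  · intro t ht
    refine Eventually.of_forall fun x => ?_
    rw [Real.norm_eq_abs, abs_of_nonneg (hu.nonneg ht x)]
    exact hub t ht x
  · exact integrable_const M
  · refine Eventually.of_forall fun x => ?_
    exact hu.continuousOn.comp (continuousOn_id.prodMk continuousOn_const)
      (fun τ hτ => ⟨hτ, Set.mem_univ _⟩)

lemma continuousOn_cubeDeviation (hu : IsGlobalWeakSolution u u₀)
    (hu₀ : MemHper 2 (fun h => u₀ h ^ 3)) :
    ContinuousOn (fun t => cubeDeviation (u t)) (Set.Ici 0) := by
  obtain ⟨M, hM, hub⟩ := hu.exists_upper_bound hu₀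
  apply continuousOn_of_dominated (bound := fun _ => (M ^ 3) ^ 2)
  · intro t ht
    exact (((hu.continuous_slice ht).pow 3).sub continuous_const).pow 2 |>.aestronglyMeasurable
  · intro t ht
    refine Eventually.of_forall fun x => ?_
    rw [Real.norm_eq_abs, abs_of_nonneg (sq_nonneg _)]
    obtain ⟨m0, mM⟩ := hu.mean_mem_Icc ht hub
    have h1 := pow_le_pow_left₀ m0 mM 3
    have h2 := pow_le_pow_left₀ (hu.nonneg ht x) (hub t ht x) 3
    have h3 := pow_nonneg m0 3
    have h4 := pow_nonneg (hu.nonneg ht x) 3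
    apply sq_le_sq' <;> linarith
  · exact integrable_const _
  · refine Eventually.of_forall fun x => ?_
    have h1 : ContinuousOn (fun t => u t x) (Set.Ici 0) :=
      hu.continuousOn.comp (continuousOn_id.prodMk continuousOn_const)
        (fun τ hτ => ⟨hτ, Set.mem_univ _⟩)
    exact ((h1.pow 3).sub ((hu.continuousOn_mean hu₀).pow 3)).pow 2

/-- On functions with values in `[0, M]` the deviation is Lipschitz for the `L¹` distance, and `u`
is 1/2-Hölder in time for that distance. -/
lemma cubeDeviation_holder (hu : IsGlobalWeakSolution u u₀)
    (hu₀ : MemHper 2 (fun h => u₀ h ^ 3)) :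
    ∃ L : ℝ, 0 ≤ L ∧ ∀ s t, 0 ≤ s → s ≤ t →
      |cubeDeviation (u t) - cubeDeviation (u s)| ≤ L * √(t - s) := by
  obtain ⟨M, hM, hub⟩ := hu.exists_upper_bound hu₀
  -- With `a`, `b` the values of `u³ - m³` at the two times, `|a + b| ≤ 2 M³` and `|a - b| ≤ 3 M²
  -- (|u t x - u s x| + d)`; integrating the last bracket gives `2 d`, whence `12`.
  refine ⟨12 * M ^ 5 * √(energy (u 0)).toReal, by positivity, fun s t hs hst => ?_⟩
  have ht := hs.trans hst
  set d := ∫ x in Set.Ioo (0 : ℝ) 1, |u t x - u s x| with hd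
  have hdb : d ≤ √(energy (u 0)).toReal * √(t - s) := hu.integral_abs_sub_le hu₀ hs hst
  have hmd : |mean (u t) - mean (u s)| ≤ d := hu.abs_mean_sub_le hs ht
  obtain ⟨m0, mM⟩ := hu.mean_mem_Icc ht hub
  obtain ⟨n0, nM⟩ := hu.mean_mem_Icc hs hub
  have hcube : ∀ a b : ℝ, 0 ≤ a → a ≤ M → 0 ≤ b → b ≤ M →
      |a ^ 3 - b ^ 3| ≤ 3 * M ^ 2 * |a - b| := by
    intro a b ha haM hb hbM
    have e : a ^ 3 - b ^ 3 = (a ^ 2 + a * b + b ^ 2) * (a - b) := by ring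
    rw [e, abs_mul, abs_of_nonneg (by positivity)]
    apply mul_le_mul_of_nonneg_right _ (abs_nonneg _)
    nlinarith [mul_nonneg ha (sub_nonneg.2 haM), mul_nonneg hb (sub_nonneg.2 hbM),
      mul_nonneg ha (sub_nonneg.2 hbM)]
  have hpt : ∀ x, |(u t x ^ 3 - mean (u t) ^ 3) ^ 2 - (u s x ^ 3 - mean (u s) ^ 3) ^ 2|
      ≤ 6 * M ^ 5 * (|u t x - u s x| + d) := by
    intro x
    set a := u t x ^ 3 - mean (u t) ^ 3 with ha
    set b := u s x ^ 3 - mean (u s) ^ 3 with hb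
    have cM : ∀ c, 0 ≤ c → c ≤ M → 0 ≤ c ^ 3 ∧ c ^ 3 ≤ M ^ 3 := fun c h0 h1 =>
      ⟨pow_nonneg h0 3, pow_le_pow_left₀ h0 h1 3⟩
    have k1 := cM _ (hu.nonneg ht x) (hub t ht x)
    have k2 := cM _ (hu.nonneg hs x) (hub s hs x)
    have k3 := cM _ m0 mM
    have k4 := cM _ n0 nM
    have hab : |a + b| ≤ 2 * M ^ 3 := abs_le.2 ⟨by linarith [k1.1, k2.1, k3.2, k4.2],
      by linarith [k1.2, k2.2, k3.1, k4.1]⟩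
    have h1 := hcube _ _ (hu.nonneg ht x) (hub t ht x) (hu.nonneg hs x) (hub s hs x)
    have h2 := hcube _ _ m0 mM n0 nM
    have h3 : |a - b| ≤ 3 * M ^ 2 * (|u t x - u s x| + d) := by
      have e : a - b = (u t x ^ 3 - u s x ^ 3) - (mean (u t) ^ 3 - mean (u s) ^ 3) := by ring
      rw [e]
      refine (abs_sub _ _).trans ?_
      have := mul_le_mul_of_nonneg_left hmd (by positivity : 0 ≤ 3 * M ^ 2)
      linarith
    have e : a ^ 2 - b ^ 2 = (a + b) * (a - b) := by ring
    rw [e, abs_mul]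
    refine (mul_le_mul hab h3 (abs_nonneg _) (by positivity)).trans_eq ?_
    ring
  have hi : ∀ τ, 0 ≤ τ → IntegrableOn (fun x => (u τ x ^ 3 - mean (u τ) ^ 3) ^ 2)
      (Set.Ioo (0 : ℝ) 1) := fun τ hτ =>
    (memLp_Ioo_of_continuous ((((hu.continuous_slice hτ).pow 3).sub continuous_const).pow 2)
      1 0 1).integrable le_rfl
  have hdi : IntegrableOn (fun x => |u t x - u s x|) (Set.Ioo (0 : ℝ) 1) :=
    ((hu.integrableOn_slice ht).sub (hu.integrableOn_slice hs)).abs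
  rw [cubeDeviation, cubeDeviation, ← integral_sub (hi t ht) (hi s hs)]
  refine abs_integral_le_integral_abs.trans ?_
  have h1 := setIntegral_mono (μ := volume) (s := Set.Ioo (0 : ℝ) 1)
    ((hi t ht).sub (hi s hs)).abs ((hdi.add (integrable_const d)).const_mul (6 * M ^ 5)) hpt
  refine h1.trans ?_
  have e : ∫ x in Set.Ioo (0 : ℝ) 1, 6 * M ^ 5 * (|u t x - u s x| + d) = 12 * M ^ 5 * d := by
    rw [integral_const_mul, integral_add hdi (integrable_const d), ← hd]
    simp
    ring
  refine e.trans_le ?_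
  rw [mul_assoc (12 * M ^ 5)]
  exact mul_le_mul_of_nonneg_left hdb (by positivity)

/-- At each time the deviation is at most `6 E`, which is exactly what the dissipation of `F`
integrates; the bound does not depend on `T`. -/
lemma integral_cubeDeviation_le (hu : IsGlobalWeakSolution u u₀)
    (hu₀ : MemHper 2 (fun h => u₀ h ^ 3)) {T : ℝ} (hT : 0 < T) :
    ∫ t in Set.Ioo 0 T, cubeDeviation (u t) ≤ (freeEnergy (u 0)).toReal := by
  obtain ⟨K, -, hb⟩ := hu.exists_bounds hu₀
  have hfin : freeEnergy (u 0) ≠ ⊤ := by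
    rw [hu.freeEnergy_eq le_rfl]
    exact ENNReal.mul_ne_top (by simp) ENNReal.ofReal_ne_top
  have hi : IntegrableOn (fun t => cubeDeviation (u t)) (Set.Ioo 0 T) :=
    (((hu.continuousOn_cubeDeviation hu₀).mono (fun x hx => hx.1)).integrableOn_compact
      isCompact_Icc).mono_set Set.Ioo_subset_Icc_self
  rw [← ENNReal.ofReal_le_iff_le_toReal hfin, ofReal_integral_eq_lintegral_ofReal hi
    (Eventually.of_forall fun t => cubeDeviation_nonneg _)]
  refine le_trans ?_ (le_add_self.trans (hu T hT).second_dissipation)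
  rw [← lintegral_const_mul' _ _ (by simp)]
  apply setLIntegral_mono' measurableSet_Ioo
  intro t ht
  obtain ⟨A, -, -, hA, -, -, hdA, -⟩ := hb t ht.1.le
  exact (ENNReal.ofReal_le_ofReal hdA).trans hA

lemma cubeDeviation_tendsto (hu : IsGlobalWeakSolution u u₀)
    (hu₀ : MemHper 2 (fun h => u₀ h ^ 3)) :
    Tendsto (fun t => cubeDeviation (u t)) atTop (𝓝 0) ∧
      ∃ R : ℝ → ℝ, Tendsto R atTop (𝓝 0) ∧
        ∀ s t, 0 ≤ s → s ≤ t → ∫ τ in Set.Ioo s t, cubeDeviation (u τ) ≤ R s := by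
  obtain ⟨L, hL0, hL⟩ := hu.cubeDeviation_holder hu₀
  exact tendsto_zero_of_integrable_of_holder (fun t => cubeDeviation_nonneg _)
    (hu.continuousOn_cubeDeviation hu₀) (fun T hT => hu.integral_cubeDeviation_le hu₀ hT) hL0 hL

end IsGlobalWeakSolution

/-! ### The fourth derivative has mean zero over a period. -/

/-- A smooth step from `0` to `1` across `[0, 1 / c]`. -/
noncomputable def smoothStep (c x : ℝ) : ℝ := Real.smoothTransition (c * x)

lemma contDiff_smoothStep (c : ℝ) : ContDiff ℝ ∞ (smoothStep c) :=
  Real.smoothTransition.contDiff.comp (contDiff_const.mul contDiff_id)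

lemma smoothStep_of_nonpos {c x : ℝ} (hc : 0 < c) (hx : x ≤ 0) : smoothStep c x = 0 :=
  Real.smoothTransition.zero_of_nonpos (mul_nonpos_of_nonneg_of_nonpos hc.le hx)

lemma smoothStep_of_one_le {c x : ℝ} (hx : 1 ≤ c * x) : smoothStep c x = 1 :=
  Real.smoothTransition.one_of_one_le hx

lemma hasCompactSupport_iteratedDeriv_smoothStep {c : ℝ} (hc : 1 ≤ c) :
    HasCompactSupport (iteratedDeriv 4 (smoothStep c)) := by
  have h1 : HasCompactSupport (deriv (smoothStep c)) := by
    apply HasCompactSupport.intro (isCompact_Icc (a := (0 : ℝ)) (b := 1))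
    intro x hx
    have h : x < 0 ∨ 1 < x := by
      by_contra! hcon
      exact hx ⟨hcon.1, hcon.2⟩
    rcases h with h | h
    · have : smoothStep c =ᶠ[𝓝 x] fun _ => 0 := by
        filter_upwards [Iio_mem_nhds h] with y hy
        exact smoothStep_of_nonpos (by linarith) (le_of_lt hy)
      rw [this.deriv_eq, deriv_const]
    · have : smoothStep c =ᶠ[𝓝 x] fun _ => 1 := by
        filter_upwards [Ioi_mem_nhds h] with y hy
        have hy : 1 < y := hy
        exact smoothStep_of_one_le (by nlinarith)
      rw [this.deriv_eq, deriv_const]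
  have e : iteratedDeriv 4 (smoothStep c) = deriv (deriv (deriv (deriv (smoothStep c)))) := by
    rw [iteratedDeriv_succ, iteratedDeriv_succ, iteratedDeriv_succ, iteratedDeriv_one]
  rw [e]
  exact h1.deriv.deriv.deriv

/-- A smooth approximation of the indicator function of `(0, 1]`. -/
noncomputable def smoothPeriod (c x : ℝ) : ℝ := smoothStep c x - smoothStep c (x - 1)

lemma contDiff_smoothPeriod (c : ℝ) : ContDiff ℝ ∞ (smoothPeriod c) :=
  (contDiff_smoothStep c).sub ((contDiff_smoothStep c).comp (contDiff_id.sub contDiff_const))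

lemma smoothPeriod_eq_zero {c x : ℝ} (hc : 1 ≤ c) (hx : x ∉ Set.Icc (0 : ℝ) 2) :
    smoothPeriod c x = 0 := by
  have h : x < 0 ∨ 2 < x := by
    by_contra! hcon
    exact hx ⟨hcon.1, hcon.2⟩
  rcases h with h | h
  · rw [smoothPeriod, smoothStep_of_nonpos (by linarith) h.le,
      smoothStep_of_nonpos (by linarith) (by linarith), sub_zero]
  · rw [smoothPeriod, smoothStep_of_one_le (by nlinarith), smoothStep_of_one_le (by nlinarith),
      sub_self]

lemma abs_smoothPeriod_le (c x : ℝ) : |smoothPeriod c x| ≤ 1 := by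
  have h1 := Real.smoothTransition.nonneg (c * x)
  have h2 := Real.smoothTransition.le_one (c * x)
  have h3 := Real.smoothTransition.nonneg (c * (x - 1))
  have h4 := Real.smoothTransition.le_one (c * (x - 1))
  rw [smoothPeriod, smoothStep, smoothStep, abs_le]
  constructor <;> linarith

lemma tendsto_smoothStep {x : ℝ} :
    Tendsto (fun n : ℕ => smoothStep (n + 1) x) atTop (𝓝 ((Set.Ioi (0 : ℝ)).indicator 1 x)) := by
  apply tendsto_const_nhds.congr'
  rcases le_or_gt x 0 with hx | hx
  · refine Eventually.of_forall fun n => ?_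
    have hn : (0 : ℝ) < n + 1 := by positivity
    simp only
    rw [smoothStep_of_nonpos hn hx, Set.indicator_of_notMem (by simpa using hx)]
  · filter_upwards [(tendsto_natCast_atTop_atTop (R := ℝ)).eventually_ge_atTop (1 / x)] with n hn
    rw [div_le_iff₀ hx] at hn
    have hn' : 1 ≤ ((n : ℝ) + 1) * x := by linarith
    rw [Set.indicator_of_mem (by simpa using hx), smoothStep_of_one_le hn', Pi.one_apply]

/-- The limit is half-open, `(0, 1]`, because the step vanishes at its left end. -/
lemma tendsto_smoothPeriod (x : ℝ) :
    Tendsto (fun n : ℕ => smoothPeriod (n + 1) x) atTop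
      (𝓝 ((Set.Ioc (0 : ℝ) 1).indicator 1 x)) := by
  have h := (tendsto_smoothStep (x := x)).sub (tendsto_smoothStep (x := x - 1))
  convert! h using 2
  by_cases h0 : 0 < x <;> by_cases h1 : x ≤ 1
  · simp [h0, h1]
  · simp [h0, h1, not_le.1 h1]
  · simp [h0, h1]
  · exact absurd (by linarith) h1

/-- The fourth derivative is `H(x) - H(x - 1)` with `H` compactly supported; against a periodic `v`
the two integrals agree. -/
lemma integral_mul_iteratedDeriv_smoothPeriod {c : ℝ} (hc : 1 ≤ c) {v : ℝ → ℝ}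
    (hv : Continuous v) (hper : Function.Periodic v 1) :
    ∫ x, v x * iteratedDeriv 4 (smoothPeriod c) x = 0 := by
  set H := iteratedDeriv 4 (smoothStep c) with hH
  have hHc : Continuous H :=
    (contDiff_infty.1 (contDiff_smoothStep c) 4).continuous_iteratedDeriv' 4
  have hHs : HasCompactSupport H := hasCompactSupport_iteratedDeriv_smoothStep hc
  have e : ∀ x, iteratedDeriv 4 (smoothPeriod c) x = H x - H (x - 1) := by
    intro x
    have hd : ∀ y, ContDiffAt ℝ (4 : ℕ) (smoothStep c) y := fun y =>
      (contDiff_infty.1 (contDiff_smoothStep c) 4).contDiffAt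
    have h1 := iteratedDeriv_sub (n := 4) (f := smoothStep c)
      (g := fun y => smoothStep c (y - 1)) (hd x)
      (ContDiffAt.comp (g := smoothStep c) (f := fun y => y - 1) x (hd (x - 1))
        (contDiff_id.sub contDiff_const).contDiffAt)
    rw [iteratedDeriv_comp_sub_const] at h1
    exact h1
  have hvH : Integrable (fun x => v x * H x) :=
    (hv.mul hHc).integrable_of_hasCompactSupport hHs.mul_left
  have hshift : ∀ x, v x * H (x - 1) = v (x - 1) * H (x - 1) := fun x => by
    rw [hper.sub_eq]
  simp only [e, mul_sub, hshift]
  rw [integral_sub hvH (hvH.comp_sub_right 1), integral_sub_right_eq_self (fun x => v x * H x) 1,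
    sub_self]

/-- The weak fourth derivative of a periodic function has mean zero over a period. -/
lemma integral_weakDhhhh_eq_zero {Ω : Set (ℝ × ℝ)} (hΩ : IsOpen Ω) {v g : ℝ × ℝ → ℝ}
    (hg : IsWeakDhhhh Ω v g) {s t M : ℝ} (hst : Set.Ioo s t ×ˢ Set.univ ⊆ Ω)
    (hvm : ContinuousOn v (Set.Ioo s t ×ˢ Set.univ))
    (hvM : ∀ τ ∈ Set.Ioo s t, ∀ x, |v (τ, x)| ≤ M)
    (hvc : ∀ τ ∈ Set.Ioo s t, Continuous fun x => v (τ, x))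
    (hvp : ∀ τ ∈ Set.Ioo s t, Function.Periodic (fun x => v (τ, x)) 1) {χ : ℝ → ℝ}
    (hχ : ContDiff ℝ ∞ χ) (hχc : HasCompactSupport χ) (hχs : tsupport χ ⊆ Set.Ioo s t) :
    ∫ p in Set.Ioo s t ×ˢ Set.Ioo (0 : ℝ) 1, χ p.1 * g p = 0 := by
  -- `g` is only locally integrable on `Ω`. The compact set `K` contains the supports of all test
  -- functions `χ ⊗ smoothPeriod (n + 1)`, so `g` is integrable where it is needed, uniformly in
  -- `n`.
  set K : Set (ℝ × ℝ) := tsupport χ ×ˢ Set.Icc (0 : ℝ) 2 with hK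
  have hKc : IsCompact K := hχc.isCompact.prod isCompact_Icc
  have hKm : MeasurableSet K := hKc.measurableSet
  have hKΩ : K ⊆ Ω := (Set.prod_mono hχs (Set.subset_univ _)).trans hst
  have hSm : MeasurableSet (Set.Ioo s t ×ˢ (Set.univ : Set ℝ)) :=
    measurableSet_Ioo.prod MeasurableSet.univ
  have hgK : IntegrableOn g K := hg.2.1.integrableOn_compact_subset hKΩ hKc
  have hχz : ∀ τ, τ ∉ tsupport χ → χ τ = 0 := fun τ hτ => image_eq_zero_of_notMem_tsupport hτ
  obtain ⟨C, hC⟩ := hχ.continuous.bounded_above_of_compact_support hχc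
  have hn : ∀ n : ℕ, ∫ p in K, g p * (χ p.1 * smoothPeriod (n + 1) p.2) = 0 := by
    intro n
    have hc : (1 : ℝ) ≤ n + 1 := by
      have : (0 : ℝ) ≤ n := n.cast_nonneg
      linarith
    set ζ := smoothPeriod (n + 1) with hζ
    have hζd : ContDiff ℝ ∞ ζ := contDiff_smoothPeriod _
    have hζz : ∀ x, x ∉ Set.Icc (0 : ℝ) 2 → ζ x = 0 := fun x hx => smoothPeriod_eq_zero hc hx
    have hζc : HasCompactSupport ζ := HasCompactSupport.intro isCompact_Icc hζz
    have h := hg.2.2 _ (contDiff_tensor hχ hζd) (hasCompactSupport_tensor hχc hζc)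
      ((tsupport_tensor_subset χ ζ).trans
        ((Set.prod_mono hχs (Set.subset_univ _)).trans hst))
    have hd : ∀ p : ℝ × ℝ, iteratedDeriv 4 (fun y => χ p.1 * ζ y) p.2
        = χ p.1 * iteratedDeriv 4 ζ p.2 := fun p => by
      rw [iteratedDeriv_const_mul_field]
    simp only [hd] at h
    have hZc : Continuous (iteratedDeriv 4 ζ) :=
      (contDiff_infty.1 hζd 4).continuous_iteratedDeriv' 4
    have hZs : HasCompactSupport (iteratedDeriv 4 ζ) := by
      have e : iteratedDeriv 4 ζ = deriv (deriv (deriv (deriv ζ))) := by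
        rw [iteratedDeriv_succ, iteratedDeriv_succ, iteratedDeriv_succ, iteratedDeriv_one]
      rw [e]
      exact hζc.deriv.deriv.deriv.deriv
    -- For each fixed time the integral in `x` vanishes by periodicity of `v`. No periodicity of `g`
    -- is needed.
    have hleft : ∫ p in Ω, v p * (χ p.1 * iteratedDeriv 4 ζ p.2) = 0 := by
      rw [setIntegral_eq_of_subset_of_forall_sdiff_eq_zero hΩ.measurableSet hst]
      · have hi : IntegrableOn (fun p : ℝ × ℝ => v p * (χ p.1 * iteratedDeriv 4 ζ p.2))
            (Set.Ioo s t ×ˢ Set.univ) := by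
          have h0 : Integrable (fun p : ℝ × ℝ => χ p.1 * iteratedDeriv 4 ζ p.2) :=
            (hχ.continuous.integrable_of_hasCompactSupport hχc).mul_prod
              (hZc.integrable_of_hasCompactSupport hZs)
          apply Integrable.bdd_mul (c := M) h0.integrableOn (hvm.aestronglyMeasurable hSm)
          filter_upwards [ae_restrict_mem hSm] with p hp
          exact hvM p.1 hp.1 p.2
        rw [Measure.volume_eq_prod] at hi ⊢
        rw [setIntegral_prod _ hi]
        apply integral_eq_zero_of_ae
        filter_upwards [ae_restrict_mem measurableSet_Ioo] with τ hτ
        have e : ∀ x, v (τ, x) * (χ τ * iteratedDeriv 4 ζ x)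
            = χ τ * (v (τ, x) * iteratedDeriv 4 ζ x) := fun x => by ring
        simp only [e, Measure.restrict_univ]
        rw [integral_const_mul,
          integral_mul_iteratedDeriv_smoothPeriod hc (hvc τ hτ) (hvp τ hτ), mul_zero]
        rfl
      · intro p hp
        rw [hχz p.1 fun hcon => hp.2 ⟨hχs hcon, Set.mem_univ _⟩]
        ring
    rw [hleft, setIntegral_eq_of_subset_of_forall_sdiff_eq_zero hΩ.measurableSet hKΩ] at h
    · exact h.symm
    · intro p hp
      by_cases h1 : p.1 ∈ tsupport χ
      · rw [hζz p.2 fun hcon => hp.2 ⟨h1, hcon⟩]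
        ring
      · rw [hχz p.1 h1]
        ring
  have hgχ : IntegrableOn (fun p : ℝ × ℝ => g p * χ p.1) K :=
    Integrable.mul_bdd (c := C) hgK (hχ.continuous.comp continuous_fst).aestronglyMeasurable
      (Eventually.of_forall fun p => hC p.1)
  -- As the steps sharpen, the cutoff becomes the indicator of exactly one period.
  have hlim : Tendsto (fun n : ℕ => ∫ p in K, g p * (χ p.1 * smoothPeriod (n + 1) p.2)) atTop
      (𝓝 (∫ p in K, g p * χ p.1 * (Set.Ioc (0 : ℝ) 1).indicator 1 p.2)) := by
    apply tendsto_integral_of_dominated_convergence (fun p => ‖g p * χ p.1‖)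
    · intro n
      have : (fun p : ℝ × ℝ => g p * (χ p.1 * smoothPeriod (n + 1) p.2))
          = fun p => g p * χ p.1 * smoothPeriod (n + 1) p.2 := by
        ext p; ring
      rw [this]
      exact hgχ.aestronglyMeasurable.mul
        ((contDiff_smoothPeriod _).continuous.comp continuous_snd).aestronglyMeasurable
    · exact hgχ.norm
    · intro n
      refine Eventually.of_forall fun p => ?_
      rw [← mul_assoc, norm_mul]
      exact mul_le_of_le_one_right (norm_nonneg _) (abs_smoothPeriod_le _ _)
    · refine Eventually.of_forall fun p => ?_
      simp only [← mul_assoc]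
      exact (tendsto_smoothPeriod p.2).const_mul _
  have hK0 : ∫ p in K, g p * χ p.1 * (Set.Ioc (0 : ℝ) 1).indicator 1 p.2 = 0 := by
    simp only [hn] at hlim
    exact tendsto_nhds_unique hlim tendsto_const_nhds
  have hfinal : ∫ p in Set.Ioo s t ×ˢ Set.Ioo (0 : ℝ) 1, χ p.1 * g p
      = ∫ p in K, g p * χ p.1 * (Set.Ioc (0 : ℝ) 1).indicator 1 p.2 := by
    have hIoc : (Set.Ioo s t ×ˢ Set.Ioo (0 : ℝ) 1 : Set (ℝ × ℝ)) =ᵐ[volume]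
        (Set.Ioo s t ×ˢ Set.Ioc (0 : ℝ) 1 : Set (ℝ × ℝ)) :=
      Measure.set_prod_ae_eq (ae_eq_refl _) Ioo_ae_eq_Ioc
    rw [setIntegral_congr_set hIoc]
    have hm : MeasurableSet (Set.Ioo s t ×ˢ Set.Ioc (0 : ℝ) 1) :=
      measurableSet_Ioo.prod measurableSet_Ioc
    rw [← integral_indicator hm, ← integral_indicator hKm]
    congr 1
    ext p
    by_cases h1 : p.1 ∈ tsupport χ
    · have h1' := hχs h1
      by_cases h2 : p.2 ∈ Set.Ioc (0 : ℝ) 1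
      · rw [Set.indicator_of_mem (show p ∈ Set.Ioo s t ×ˢ Set.Ioc (0 : ℝ) 1 from ⟨h1', h2⟩),
          Set.indicator_of_mem (show p ∈ K from ⟨h1, h2.1.le, by linarith [h2.2]⟩),
          Set.indicator_of_mem h2, Pi.one_apply]
        ring
      · rw [Set.indicator_of_notMem fun h : p ∈ Set.Ioo s t ×ˢ Set.Ioc (0 : ℝ) 1 => h2 h.2]
        by_cases hpK : p ∈ K
        · rw [Set.indicator_of_mem hpK, Set.indicator_of_notMem h2, mul_zero]
        · rw [Set.indicator_of_notMem hpK]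
    · rw [Set.indicator_of_notMem fun h : p ∈ K => h1 h.1]
      by_cases hp : p ∈ Set.Ioo s t ×ˢ Set.Ioc (0 : ℝ) 1
      · rw [Set.indicator_of_mem hp, hχz _ h1, zero_mul]
      · rw [Set.indicator_of_notMem hp]
  rw [hfinal, hK0]

/-! ### Drift of the mean while the solution is bounded below. -/

/-- Once the factor `a - m` is removed, this is `δ (a + m) ≤ a² + a m + m²`. -/
lemma sq_sub_sq_sq_le {a m δ : ℝ} (hδ : 0 < δ) (ha : δ ≤ a) (hm : δ ≤ m) :
    (a ^ 2 - m ^ 2) ^ 2 ≤ (δ ^ 2)⁻¹ * (a ^ 3 - m ^ 3) ^ 2 := by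
  rw [inv_mul_eq_div, le_div_iff₀ (by positivity), mul_comm, ← mul_pow]
  have e1 : δ * (a ^ 2 - m ^ 2) = (a - m) * (δ * (a + m)) := by ring
  have e2 : a ^ 3 - m ^ 3 = (a - m) * (a ^ 2 + a * m + m ^ 2) := by ring
  rw [e1, e2, mul_pow (a - m), mul_pow (a - m)]
  apply mul_le_mul_of_nonneg_left _ (sq_nonneg _)
  have ha0 : 0 < a := hδ.trans_le ha
  have hm0 : 0 < m := hδ.trans_le hm
  apply pow_le_pow_left₀ (by positivity)
  nlinarith [mul_nonneg ha0.le (sub_nonneg.2 ha), mul_nonneg hm0.le (sub_nonneg.2 hm),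
    mul_pos ha0 hm0]

namespace IsGlobalWeakSolution

/-- As long as the solution is bounded below, the change of its mean is controlled by the
deviation from the mean. -/
lemma sq_mean_sub_le (hu : IsGlobalWeakSolution u u₀) (hu₀ : MemHper 2 (fun h => u₀ h ^ 3))
    {δ s t : ℝ} (hδ : 0 < δ) (hs : 0 ≤ s) (hst : s ≤ t)
    (hlow : ∀ τ ∈ Set.Icc s t, ∀ x, δ ≤ u τ x) :
    (mean (u t) - mean (u s)) ^ 2 ≤ (δ ^ 6)⁻¹ * (energy (u 0)).toReal *
      ∫ τ in Set.Ioo s t, cubeDeviation (u τ) := by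
  obtain ⟨M, hM, hub⟩ := hu.exists_upper_bound hu₀
  have hT : 0 < t + 1 := by linarith
  obtain ⟨ut, g, hut, hut2, hg, hutg, hE⟩ := hu.exists_timeDeriv hu₀ hT
  have hIoo : Set.Ioo s t ⊆ Set.Ioo 0 (t + 1) := Set.Ioo_subset_Ioo hs (by linarith)
  set Q : Set (ℝ × ℝ) := Set.Ioo s t ×ˢ Set.Ioo (0 : ℝ) 1 with hQ
  have hQm : MeasurableSet Q := measurableSet_Ioo.prod measurableSet_Ioo
  have hsub : Q ⊆ Set.Ioo 0 (t + 1) ×ˢ Set.Ioo (0 : ℝ) 1 := Set.prod_mono hIoo le_rfl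
  have hpos : ∀ p ∈ Q, 0 ≤ p.1 := fun p hp => hs.trans hp.1.1.le
  have hlowQ : ∀ p ∈ Q, δ ≤ u p.1 p.2 := fun p hp => hlow p.1 (Set.Ioo_subset_Icc_self hp.1) _
  have hmlow : ∀ τ ∈ Set.Icc s t, δ ≤ mean (u τ) := by
    intro τ hτ
    obtain ⟨y, -, hy⟩ := exists_le_integral_Ioo (hu.integrableOn_slice (hs.trans hτ.1))
    exact (hlow τ hτ y).trans hy
  have hut2' : MemLp ut 2 (volume.restrict Q) :=
    hut2.mono_measure (Measure.restrict_mono hsub le_rfl)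
  have hucont : ContinuousOn (fun p : ℝ × ℝ => u p.1 p.2) Q :=
    hu.continuousOn.mono fun p hp => ⟨hpos p hp, Set.mem_univ _⟩
  have hmcont : ContinuousOn (fun p : ℝ × ℝ => mean (u p.1)) Q :=
    (hu.continuousOn_mean hu₀).comp continuous_fst.continuousOn fun p hp => hpos p hp
  -- Dividing the equation by `u² ≥ δ²` gives `k = -(u³)_hhhh` on `Q`, a pure derivative in `h`.
  set k : ℝ × ℝ → ℝ := fun p => (u p.1 p.2 ^ 2)⁻¹ * ut p with hk
  have hinv : ∀ p ∈ Q, 0 < u p.1 p.2 := fun p hp => hδ.trans_le (hlowQ p hp)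
  have hk2 : MemLp k 2 (volume.restrict Q) := by
    apply MemLp.of_le_mul (c := (δ ^ 2)⁻¹) hut2'
    · apply AEStronglyMeasurable.mul _ hut2'.1
      exact ((hucont.pow 2).inv₀ fun p hp =>
        (pow_pos (hinv p hp) 2).ne').aestronglyMeasurable hQm
    · filter_upwards [ae_restrict_mem hQm] with p hp
      rw [hk, norm_mul]
      apply mul_le_mul_of_nonneg_right _ (norm_nonneg _)
      rw [norm_inv, norm_pow, Real.norm_eq_abs, abs_of_pos (hinv p hp)]
      have := hlowQ p hp
      gcongr
  have hki : IntegrableOn k Q := hk2.integrable (by norm_num)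
  have hkint : ∫ p in Q, k p ^ 2 ≤ (δ ^ 4)⁻¹ * (energy (u 0)).toReal := by
    have h1 : ∫ p in Q, k p ^ 2 ≤ ∫ p in Q, (δ ^ 4)⁻¹ * ut p ^ 2 := by
      apply setIntegral_mono_on hk2.integrable_sq (hut2'.integrable_sq.const_mul _) hQm
      intro p hp
      rw [hk, mul_pow]
      apply mul_le_mul_of_nonneg_right _ (sq_nonneg _)
      rw [inv_pow, ← pow_mul]
      have := hlowQ p hp
      norm_num
      gcongr
    refine h1.trans ?_
    rw [integral_const_mul]
    apply mul_le_mul_of_nonneg_left _ (by positivity)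
    exact (setIntegral_mono_set hut2.integrable_sq (Eventually.of_forall fun _ => sq_nonneg _)
      hsub.eventuallyLE).trans hE
  have hgk : ∀ᵐ p, p ∈ Q → g p = -k p := by
    filter_upwards [hutg] with p hp hpQ
    have hmem : p ∈ periodPositiveSet (t + 1) u := ⟨hIoo hpQ.1, hpQ.2, (hinv p hpQ).ne'⟩
    have hu2 := (pow_pos (hinv p hpQ) 2).ne'
    simp only [hk]
    rw [hp hmem, mul_neg, neg_neg, inv_mul_cancel_left₀ hu2]
  have hJ : ∀ᵐ τ : ℝ, τ ∈ Set.Ioo s t → ∫ x in Set.Ioo (0 : ℝ) 1, k (τ, x) = 0 := by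
    have hki' := hki
    rw [hQ, IntegrableOn, volume_restrict_Ioo_prod] at hki'
    have hJi : IntegrableOn (fun τ => ∫ x in Set.Ioo (0 : ℝ) 1, k (τ, x)) (Set.Ioo s t) :=
      hki'.integral_prod_left
    apply isOpen_Ioo.ae_eq_zero_of_integral_contDiff_smul_eq_zero hJi.locallyIntegrableOn
    intro χ hχ hχc hχs
    have hz := integral_weakDhhhh_eq_zero (hu.isOpen_positiveSet (t + 1)) hg (M := M ^ 3)
      (fun p hp => ⟨hIoo hp.1, (hδ.trans_le (hlow p.1 (Set.Ioo_subset_Icc_self hp.1) _)).ne'⟩)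
      ((hu.continuousOn.mono fun p hp => ⟨hs.trans hp.1.1.le, Set.mem_univ _⟩).pow 3)
      (fun τ hτ x => by
        have hτ0 := hs.trans hτ.1.le
        rw [abs_of_nonneg (pow_nonneg (hu.nonneg hτ0 x) 3)]
        exact pow_le_pow_left₀ (hu.nonneg hτ0 x) (hub τ hτ0 x) 3)
      (fun τ hτ => (hu.continuous_slice (hs.trans hτ.1.le)).pow 3)
      (fun τ hτ x => by
        have := hu.periodic (hs.trans hτ.1.le) x
        simp only [this]) hχ hχc hχs
    have h1 : ∫ p in Q, χ p.1 * g p = ∫ p in Q, -(χ p.1 * k p) := by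
      apply setIntegral_congr_ae hQm
      filter_upwards [hgk] with p hp hpQ
      rw [hp hpQ, mul_neg]
    obtain ⟨C, hC⟩ := hχ.continuous.bounded_above_of_compact_support hχc
    have hi : IntegrableOn (fun p : ℝ × ℝ => χ p.1 * k p) Q :=
      Integrable.bdd_mul (c := C) hki (hχ.continuous.comp continuous_fst).aestronglyMeasurable
        (Eventually.of_forall fun p => hC p.1)
    rw [h1, integral_neg, neg_eq_zero, hQ, volume_restrict_Ioo_prod] at hz
    rw [hQ, IntegrableOn, volume_restrict_Ioo_prod] at hi
    rw [integral_prod _ hi] at hz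
    simp only [integral_const_mul] at hz
    rw [← setIntegral_eq_integral_of_forall_compl_eq_zero (s := Set.Ioo s t)]
    · exact hz
    · intro τ hτ
      rw [image_eq_zero_of_notMem_tsupport fun h => hτ (hχs h), zero_smul]
  have hmki : IntegrableOn (fun p : ℝ × ℝ => mean (u p.1) ^ 2 * k p) Q := by
    apply Integrable.bdd_mul (c := M ^ 2) hki ((hmcont.pow 2).aestronglyMeasurable hQm)
    filter_upwards [ae_restrict_mem hQm] with p hp
    obtain ⟨m0, mM⟩ := hu.mean_mem_Icc (hpos p hp) hub
    rw [Real.norm_eq_abs, abs_of_nonneg (sq_nonneg _)]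
    exact pow_le_pow_left₀ m0 mM 2
  -- The factor `mean (u τ) ^ 2` depends on time only, so `hJ` annihilates this term. It can
  -- therefore be subtracted in `hsplit`, which brings in `u² - m²`, a quantity controlled by the
  -- deviation.
  have hmk : ∫ p in Q, mean (u p.1) ^ 2 * k p = 0 := by
    have hmki' := hmki
    rw [hQ, IntegrableOn, volume_restrict_Ioo_prod] at hmki'
    rw [hQ, volume_restrict_Ioo_prod, integral_prod _ hmki']
    simp only [integral_const_mul]
    apply integral_eq_zero_of_ae
    rw [EventuallyEq, ae_restrict_iff' measurableSet_Ioo]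
    filter_upwards [hJ] with τ hτ hτ'
    rw [hτ hτ', mul_zero, Pi.zero_apply]
  have hwcont : ContinuousOn (fun p : ℝ × ℝ => u p.1 p.2 ^ 2 - mean (u p.1) ^ 2) Q :=
    (hucont.pow 2).sub (hmcont.pow 2)
  have hdcont : ContinuousOn (fun p : ℝ × ℝ => u p.1 p.2 ^ 3 - mean (u p.1) ^ 3) Q :=
    (hucont.pow 3).sub (hmcont.pow 3)
  have hpowbd : ∀ n : ℕ, ∀ p ∈ Q, ‖u p.1 p.2 ^ n - mean (u p.1) ^ n‖ ≤ M ^ n := by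
    intro n p hp
    obtain ⟨m0, mM⟩ := hu.mean_mem_Icc (hpos p hp) hub
    have h0 := hu.nonneg (hpos p hp) p.2
    have h1 := pow_le_pow_left₀ m0 mM n
    have h2 := pow_le_pow_left₀ h0 (hub _ (hpos p hp) p.2) n
    rw [Real.norm_eq_abs, abs_le]
    constructor <;> linarith [pow_nonneg m0 n, pow_nonneg h0 n]
  have hw2 : MemLp (fun p : ℝ × ℝ => u p.1 p.2 ^ 2 - mean (u p.1) ^ 2) 2 (volume.restrict Q) := by
    apply MemLp.of_bound (hwcont.aestronglyMeasurable hQm) (M ^ 2)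
    filter_upwards [ae_restrict_mem hQm] with p hp using hpowbd 2 p hp
  have hd2 : MemLp (fun p : ℝ × ℝ => u p.1 p.2 ^ 3 - mean (u p.1) ^ 3) 2 (volume.restrict Q) := by
    apply MemLp.of_bound (hdcont.aestronglyMeasurable hQm) (M ^ 3)
    filter_upwards [ae_restrict_mem hQm] with p hp using hpowbd 3 p hp
  have hmean := hu.mean_sub_eq hu₀ hT hut (hut2.integrable (by norm_num)) hs hst (by linarith)
  have hsplit : ∫ p in Q, ut p = ∫ p in Q, (u p.1 p.2 ^ 2 - mean (u p.1) ^ 2) * k p := by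
    have h1 : ∫ p in Q, (u p.1 p.2 ^ 2 - mean (u p.1) ^ 2) * k p
        = ∫ p in Q, (ut p - mean (u p.1) ^ 2 * k p) := by
      apply setIntegral_congr_fun hQm
      intro p hp
      have hu2 := (pow_pos (hinv p hp) 2).ne'
      have e : u p.1 p.2 ^ 2 * k p = ut p := mul_inv_cancel_left₀ hu2 _
      simp only [sub_mul, e]
    rw [h1, integral_sub (hut2'.integrable (by norm_num)) hmki, hmk, sub_zero]
  have hdev : ∫ p in Q, (u p.1 p.2 ^ 3 - mean (u p.1) ^ 3) ^ 2
      = ∫ τ in Set.Ioo s t, cubeDeviation (u τ) := by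
    have hi := hd2.integrable_sq
    rw [hQ, volume_restrict_Ioo_prod] at hi ⊢
    rw [integral_prod _ hi]
    rfl
  have hwint : ∫ p in Q, (u p.1 p.2 ^ 2 - mean (u p.1) ^ 2) ^ 2
      ≤ (δ ^ 2)⁻¹ * ∫ τ in Set.Ioo s t, cubeDeviation (u τ) := by
    rw [← hdev, ← integral_const_mul]
    apply setIntegral_mono_on hw2.integrable_sq (hd2.integrable_sq.const_mul _) hQm
    intro p hp
    exact sq_sub_sq_sq_le hδ (hlowQ p hp) (hmlow p.1 (Set.Ioo_subset_Icc_self hp.1))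
  rw [hmean, hsplit]
  refine (sq_integral_mul_le hw2 hk2).trans ?_
  refine (mul_le_mul hwint hkint (integral_nonneg fun _ => sq_nonneg _) ?_).trans_eq ?_
  · rw [← hdev]
    exact mul_nonneg (by positivity) (integral_nonneg fun _ => sq_nonneg _)
  · have : (δ ^ 6)⁻¹ = (δ ^ 2)⁻¹ * (δ ^ 4)⁻¹ := by rw [← mul_inv, ← pow_add]
    rw [this]
    ring

end IsGlobalWeakSolution

/-! ### Convergence of the mean and of the solution. -/

namespace IsGlobalWeakSolution

lemma eventually_abs_sub_mean_le (hu : IsGlobalWeakSolution u u₀)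
    (hu₀ : MemHper 2 (fun h => u₀ h ^ 3)) {ε : ℝ} (hε : 0 < ε) :
    ∀ᶠ t in atTop, ∀ x, |u t x - mean (u t)| ≤ ε := by
  obtain ⟨K, hK, hb⟩ := hu.exists_bounds hu₀
  have hten : Tendsto (fun t => cubeDeviation (u t) * K) atTop (𝓝 0) := by
    simpa using (hu.cubeDeviation_tendsto hu₀).1.mul_const K
  -- The exponent comes from `|u - m|³ ≤ |u³ - m³|`, `(u³ - m³)² ≤ A` and `A² ≤ D K`, which combine
  -- to `|u - m|¹² ≤ D K`.
  filter_upwards [hten.eventually_lt_const (u := ε ^ 12) (by positivity),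
    eventually_ge_atTop 0] with t ht ht0 y
  obtain ⟨x, hx, hxe⟩ := hu.exists_eq_fract y
  rw [hxe t ht0]
  obtain ⟨A, hA, -, -, -, hmean, -, hAK, -⟩ := hb t ht0
  have h1 := hmean x hx
  have h2 : |u t x - mean (u t)| ^ 3 ≤ |u t x ^ 3 - mean (u t) ^ 3| :=
    pow_three_abs_sub_le (hu.nonneg ht0 x) (integral_nonneg (hu.nonneg ht0))
  have h3 : (|u t x - mean (u t)| ^ 3) ^ 4 ≤ A ^ 2 := by
    calc (|u t x - mean (u t)| ^ 3) ^ 4 ≤ |u t x ^ 3 - mean (u t) ^ 3| ^ 4 := by gcongr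
      _ = ((u t x ^ 3 - mean (u t) ^ 3) ^ 2) ^ 2 := by
          rw [Even.pow_abs (by decide : Even 4)]; ring
      _ ≤ A ^ 2 := by gcongr
  rw [← pow_mul] at h3
  exact le_of_pow_le_pow_left₀ (by norm_num) hε.le ((h3.trans hAK).trans ht.le)

lemma exists_tendsto_mean (hu : IsGlobalWeakSolution u u₀)
    (hu₀ : MemHper 2 (fun h => u₀ h ^ 3)) :
    ∃ c : ℝ, Tendsto (fun t => mean (u t)) atTop (𝓝 c) := by
  by_cases h0 : Tendsto (fun t => mean (u t)) atTop (𝓝 0)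
  · exact ⟨0, h0⟩
  obtain ⟨ε, hε, hfreq⟩ : ∃ ε > 0, ∃ᶠ t in atTop, ε ≤ |mean (u t)| := by
    rw [Metric.tendsto_nhds] at h0
    push Not at h0
    obtain ⟨ε, hε, h⟩ := h0
    refine ⟨ε, hε, ?_⟩
    simpa [Real.dist_eq] using h
  -- The mean starts at `4δ` or more and is to be kept above `2δ`; as `u` is within `δ` of its mean,
  -- this leaves `u ≥ δ`.
  obtain ⟨δ, hδ, hδε⟩ : ∃ δ > 0, ε = 4 * δ := ⟨ε / 4, by positivity, by ring⟩
  set K := (δ ^ 6)⁻¹ * (energy (u 0)).toReal with hK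
  have hK0 : 0 ≤ K := mul_nonneg (by positivity) ENNReal.toReal_nonneg
  obtain ⟨R, hR, hRb⟩ := (hu.cubeDeviation_tendsto hu₀).2
  have hKR : Tendsto (fun t => K * R t) atTop (𝓝 0) := by simpa using hR.const_mul K
  have hlate := ((hu.eventually_abs_sub_mean_le hu₀ hδ).and
    (hKR.eventually_lt_const (u := δ ^ 2) (by positivity))).and (eventually_ge_atTop 0)
  obtain ⟨T₀, hT₀⟩ := eventually_atTop.1 hlate
  obtain ⟨t₁, ht₁, hm₁⟩ := frequently_atTop.1 hfreq T₀
  have hpos : ∀ t, t₁ ≤ t → 0 ≤ t := fun t ht => (hT₀ t (ht₁.trans ht)).2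
  have hlow : ∀ t, t₁ ≤ t → 2 * δ ≤ mean (u t) → ∀ x, δ ≤ u t x := by
    intro t ht hm x
    have := (hT₀ t (ht₁.trans ht)).1.1 x
    linarith [neg_abs_le (u t x - mean (u t))]
  have hm₁' : 4 * δ ≤ mean (u t₁) := by
    rwa [abs_of_nonneg (show 0 ≤ mean (u t₁) from
      integral_nonneg (hu.nonneg (hpos t₁ le_rfl))), hδε] at hm₁
  have hest : ∀ s t, t₁ ≤ s → s ≤ t → (∀ τ ∈ Set.Icc s t, 2 * δ ≤ mean (u τ)) →
      (mean (u t) - mean (u s)) ^ 2 ≤ K * R s := by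
    intro s t hs hst hm
    refine (hu.sq_mean_sub_le hu₀ hδ (hpos s hs) hst
      fun τ hτ x => hlow τ (hs.trans hτ.1) (hm τ hτ) x).trans ?_
    exact mul_le_mul_of_nonneg_left (hRb s t (hpos s hs) hst) hK0
  have hmc : ContinuousOn (fun t => mean (u t)) (Set.Ici t₁) :=
    (hu.continuousOn_mean hu₀).mono fun t ht => hpos t ht
  have hstay : ∀ t, t₁ ≤ t → 2 * δ ≤ mean (u t) := by
    intro t ht
    by_contra! hcon
    -- Continuity argument: up to the first time at level `2δ` the drift estimate is available and
    -- bounds the squared change of the mean by less than `δ²`, while reaching `2δ` from `4δ` would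
    -- need at least `4δ²`.
    set Z := Set.Icc t₁ t ∩ (fun τ => mean (u τ)) ⁻¹' {2 * δ} with hZ
    have hIcc : ∀ τ, ContinuousOn (fun t => mean (u t)) (Set.Icc t₁ τ) := fun τ =>
      hmc.mono Set.Icc_subset_Ici_self
    have hivt : ∀ τ, t₁ ≤ τ → mean (u τ) ≤ 2 * δ → ∃ r ∈ Set.Icc t₁ τ, mean (u r) = 2 * δ :=
      fun τ hτ hm => intermediate_value_Icc' hτ (hIcc τ) ⟨hm, by linarith⟩
    have hZne : Z.Nonempty := by
      obtain ⟨r, hr, hr'⟩ := hivt t ht hcon.le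
      exact ⟨r, hr, hr'⟩
    have hZc : IsCompact Z := isCompact_Icc.of_isClosed_subset
      ((hIcc t).preimage_isClosed_of_isClosed isClosed_Icc isClosed_singleton)
      Set.inter_subset_left
    obtain ⟨⟨h12, h2t⟩, hm2⟩ := hZc.sInf_mem hZne
    have hm2 : mean (u (sInf Z)) = 2 * δ := hm2
    have hbefore : ∀ τ ∈ Set.Icc t₁ (sInf Z), 2 * δ ≤ mean (u τ) := by
      intro τ hτ
      by_contra! hlt
      obtain ⟨r, hr, hr'⟩ := hivt τ hτ.1 hlt.le
      have hrZ : r ∈ Z := ⟨⟨hr.1, hr.2.trans (hτ.2.trans h2t)⟩, hr'⟩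
      have h3 := (hZc.isLeast_sInf hZne).2 hrZ
      have : τ = sInf Z := le_antisymm hτ.2 (h3.trans hr.2)
      rw [this, hm2] at hlt
      exact lt_irrefl _ hlt
    have h4 := hest t₁ (sInf Z) le_rfl h12 hbefore
    have h5 := (hT₀ t₁ ht₁).1.2
    rw [hm2] at h4
    nlinarith
  apply cauchySeq_tendsto_of_complete
  rw [Metric.cauchySeq_iff']
  intro η hη
  obtain ⟨N, hN⟩ := eventually_atTop.1 (hKR.eventually_lt_const (u := η ^ 2) (by positivity))
  refine ⟨max N t₁, fun t ht => ?_⟩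
  have h1 := hest (max N t₁) t (le_max_right _ _) ht fun τ hτ =>
    hstay τ ((le_max_right _ _).trans hτ.1)
  have h2 := hN (max N t₁) (le_max_left _ _)
  rw [Real.dist_eq]
  exact abs_lt_of_sq_lt_sq (h1.trans_lt h2) hη.le

lemma tendsto_hperNorm (hu : IsGlobalWeakSolution u u₀)
    (hu₀ : MemHper 2 (fun h => u₀ h ^ 3)) {c : ℝ}
    (hc : Tendsto (fun t => mean (u t)) atTop (𝓝 c)) :
    Tendsto (fun t => hperNorm 1 (fun h => u t h ^ 3 - c ^ 3)) atTop (𝓝 0) := by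
  obtain ⟨K, hK, hb⟩ := hu.exists_bounds hu₀
  have hD := (hu.cubeDeviation_tendsto hu₀).1
  -- The first two terms bound `‖u³ - c³‖²` by inserting `mean (u t) ^ 3`; the last bounds the
  -- derivative part, since `A² ≤ D K`.
  have hbound : Tendsto (fun t => ENNReal.ofReal (√(2 * cubeDeviation (u t)
      + 2 * (mean (u t) ^ 3 - c ^ 3) ^ 2 + √(cubeDeviation (u t) * K)))) atTop (𝓝 0) := by
    have h1 : Tendsto (fun t => √(2 * cubeDeviation (u t) + 2 * (mean (u t) ^ 3 - c ^ 3) ^ 2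
        + √(cubeDeviation (u t) * K))) atTop
        (𝓝 (√(2 * 0 + 2 * (c ^ 3 - c ^ 3) ^ 2 + √(0 * K)))) :=
      (((hD.const_mul 2).add ((((hc.pow 3).sub tendsto_const_nhds).pow 2).const_mul 2)).add
        (hD.mul_const K).sqrt).sqrt
    simpa using ENNReal.tendsto_ofReal h1
  apply tendsto_of_tendsto_of_tendsto_of_le_of_le' tendsto_const_nhds hbound
    (Eventually.of_forall fun _ => zero_le)
  filter_upwards [eventually_ge_atTop 0] with t ht
  obtain ⟨A, hA, -, -, -, -, -, hAK, hnorm⟩ := hb t ht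
  rw [hnorm]
  apply ENNReal.ofReal_le_ofReal
  apply Real.sqrt_le_sqrt
  apply add_le_add _ (Real.le_sqrt_of_sq_le hAK)
  have hi : ∀ d : ℝ, IntegrableOn (fun h => (u t h ^ 3 - d) ^ 2) (Set.Ioo (0 : ℝ) 1) := fun d =>
    (memLp_Ioo_of_continuous (((hu.continuous_slice ht).pow 3).sub
      (continuous_const (y := d))) 2 0 1).integrable_sq
  have h1 := setIntegral_mono (μ := volume) (s := Set.Ioo (0 : ℝ) 1) (hi (c ^ 3))
    (((hi (mean (u t) ^ 3)).const_mul 2).add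
      (integrable_const (2 * (mean (u t) ^ 3 - c ^ 3) ^ 2))) (fun h => by
        simp only [Pi.add_apply]
        nlinarith [sq_nonneg (u t h ^ 3 - mean (u t) ^ 3 - (mean (u t) ^ 3 - c ^ 3))])
  refine h1.trans_eq ?_
  rw [integral_add' ((hi (mean (u t) ^ 3)).const_mul 2) (integrable_const _), integral_const_mul]
  simp [cubeDeviation]

lemma tendsto_eLpNorm_top (hu : IsGlobalWeakSolution u u₀)
    (hu₀ : MemHper 2 (fun h => u₀ h ^ 3)) {c : ℝ}
    (hc : Tendsto (fun t => mean (u t)) atTop (𝓝 c)) :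
    Tendsto (fun t : ℝ => eLpNorm (fun h => u t h - c) ⊤
      (volume.restrict (Set.Ioo (0 : ℝ) 1))) atTop (𝓝 0) := by
  rw [ENNReal.tendsto_nhds_zero]
  intro ε hε
  obtain ⟨r, hr, hrε⟩ : ∃ r : ℝ, 0 < r ∧ ENNReal.ofReal r ≤ ε := by
    have htop : min ε 1 ≠ ⊤ := ne_top_of_le_ne_top ENNReal.one_ne_top (min_le_right _ _)
    refine ⟨(min ε 1).toReal, ENNReal.toReal_pos (lt_min hε one_pos).ne' htop, ?_⟩
    rw [ENNReal.ofReal_toReal htop]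
    exact min_le_left _ _
  filter_upwards [hu.eventually_abs_sub_mean_le hu₀ (half_pos hr),
    Metric.tendsto_nhds.1 hc (r / 2) (half_pos hr)] with t h1 h2
  rw [eLpNorm_exponent_top]
  refine (eLpNormEssSup_le_of_ae_bound (C := r) (Eventually.of_forall fun x => ?_)).trans hrε
  rw [Real.dist_eq] at h2
  rw [Real.norm_eq_abs]
  linarith [h1 x, abs_sub_le (u t x) (mean (u t)) c]

end IsGlobalWeakSolution

end Vicinal

theorem mainTheorem3 (u₀ : ℝ → ℝ) (hu₀ : Vicinal.MemHper 2 (fun h => u₀ h ^ 3))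
    (hu₀_nonneg : ∀ᵐ h : ℝ, 0 ≤ u₀ h)
    (hu₀_inv : ∫⁻ h in Set.Ioo (0 : ℝ) 1, (ENNReal.ofReal (u₀ h))⁻¹ < ⊤)
    (u : ℝ → ℝ → ℝ) (hu : Vicinal.IsGlobalWeakSolution u u₀) :
    ∃ uStar : ℝ,
      Tendsto (fun t : ℝ => Vicinal.hperNorm 1 (fun h => u t h ^ 3 - uStar ^ 3)) atTop (𝓝 0) ∧
      Tendsto (fun t : ℝ => eLpNorm (fun h => u t h - uStar) ⊤
        (volume.restrict (Set.Ioo (0 : ℝ) 1))) atTop (𝓝 0) := by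
  obtain ⟨c, hc⟩ := hu.exists_tendsto_mean hu₀
  exact ⟨c, hu.tendsto_hperNorm hu₀ hc, hu.tendsto_eLpNorm_top hu₀ hc⟩
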